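/- A 2.5D terrain $\mathcal T$ is an $xy$-monotone polyhedral surface in $\mathbb R^3$: the graph of a continuous function over a convex polygon that is linear on each triangle of a (face-to-face) triangulation of the polygon. A point $q\in\mathcal T$ is visible from $p\in\mathcal T$ if the segment $\overline{pq}$ contains no point strictly below the surface. Let $\mathcal P$ be a set of viewpoints placed on vertices of $\mathcal T$. - The visibility map subdivides $\mathcal T$ into the part visible from at least one viewpoint of $\mathcal P$ and the invisible part. - The colored visibility map subdivides $\mathcal T$ according to the set of viewpoints in $\mathcal P$ that see a point. - The Voronoi visibility map subdivides $\mathcal T$ according to which viewpoint, among those in $\mathcal P$ that see the point, is closest to it in Euclidean distance. The complexity of such a map is its total number of vertices, edges and faces; the vertices and edges of $\mathcal T$, and the crossings of region boundaries with edges of $\mathcal T$, count. **Proposition.** The visibility map can have complexity $\Omega(m^2n^2)$, and so can the colored visibility map and the Voronoi visibility map. Precisely: there are constants $c>0$ and $K$ such that for all integers $m\ge 1$ and $n\ge Km$ there are a 2.5D terrain $\mathcal T$ with exactly $n$ vertices and a set $\mathcal P$ of exactly $m$ of its vertices, as viewpoints, such that each of the visibility map, the colored visibility map and the Voronoi visibility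 map of $(\mathcal T,\mathcal P)$ has complexity at least $c\,m^2n^2$. -/

import Mathlib

open Topology

/-- The horizontal coordinate plane, over which terrains live. -/
abbrev Plane : Type := ℝ × ℝ

/-- Three-dimensional space: a point of the horizontal plane together with an altitude. -/
abbrev Space : Type := Plane × ℝ

/-- Euclidean distance in three-dimensional space. (The metric that Mathlib puts on a product is the
sup metric, hence the explicit formula.) -/
noncomputable def euclDist (p q : Space) : ℝ :=
  Real.sqrt ((p.1.1 - q.1.1) ^ 2 + (p.1.2 - q.1.2) ^ 2 + (p.2 - q.2) ^ 2)

/-- A 2.5D terrain: an `xy`-monotone polyhedral surface in three-dimensional space, that is, the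
graph of a continuous piecewise linear function over a triangulated convex polygon.
`vertices` and `triangles` are the vertices and the faces of the terrain, projected vertically to the
plane; `height` is the altitude of the surface (only its values over the domain matter). -/
structure Terrain where
  vertices : Finset Plane
  triangles : Finset (Finset Plane)
  height : Plane → ℝ
  triangles_nonempty : triangles.Nonempty
  triangle_subset : ∀ t ∈ triangles, t ⊆ vertices
  triangle_card : ∀ t ∈ triangles, t.card = 3
  /-- triangles are not degenerate -/
  triangle_indep : ∀ t ∈ triangles, AffineIndependent ℝ (fun v : t => (v : Plane))
  vertex_mem : ∀ v ∈ vertices, ∃ t ∈ triangles, v ∈ t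
  /-- two triangles meet in a common face (a vertex, an edge, everything) or not at all -/
  face_to_face : ∀ s ∈ triangles, ∀ t ∈ triangles,
    convexHull ℝ (s : Set Plane) ∩ convexHull ℝ (t : Set Plane) ⊆
      convexHull ℝ ((s : Set Plane) ∩ (t : Set Plane))
  /-- the domain is convex -/
  convex_domain : Convex ℝ (⋃ t ∈ triangles, convexHull ℝ (t : Set Plane))
  /-- the surface is linear over each triangle -/
  height_affine : ∀ t ∈ triangles, ∃ a b c : ℝ, ∀ u ∈ convexHull ℝ (t : Set Plane),
    height u = a * u.1 + b * u.2 + c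

namespace Terrain

/-- The vertical projection of the terrain. -/
def domain (T : Terrain) : Set Plane := ⋃ t ∈ T.triangles, convexHull ℝ (t : Set Plane)

/-- The point of the surface above (or below) the point `u` of the domain. -/
def lift (T : Terrain) (u : Plane) : Space := (u, T.height u)

/-- The point `w` of space lies strictly below the terrain surface. -/
def StrictlyBelow (T : Terrain) (w : Space) : Prop := w.1 ∈ T.domain ∧ w.2 < T.height w.1

/-- The point of the terrain over `q` is visible from the point of the terrain over `p`: the segment
between them contains no point strictly below the surface. -/
def Sees (T : Terrain) (p q : Plane) : Prop :=
  p ∈ T.domain ∧ q ∈ T.domain ∧ ∀ w ∈ segment ℝ (T.lift p) (T.lift q), ¬ T.StrictlyBelow w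

/-- The (projected) viewshed of `p`. -/
def viewshed (T : Terrain) (p : Plane) : Set Plane := {q | T.Sees p q}

/-- The (projected) viewshed of a set of viewpoints. -/
def viewshedOf (T : Terrain) (P : Finset Plane) : Set Plane := ⋃ p ∈ P, T.viewshed p

/-- The Voronoi viewshed of `p` among the viewpoints `P`: the points seen by `p` to which no
viewpoint of `P` that sees them is closer than `p`. -/
def voronoiViewshed (T : Terrain) (P : Finset Plane) (p : Plane) : Set Plane :=
  {q | q ∈ T.viewshed p ∧ ∀ p' ∈ P, q ∈ T.viewshed p' →
    euclDist (T.lift p) (T.lift q) ≤ euclDist (T.lift p') (T.lift q)}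

end Terrain

/-! ### Cells of a planar subdivision that is described by a labelling of the plane -/

/-- Near `x`, the labelling `f` is invariant under translations in the direction `v`. -/
def LocInvariant {α : Type*} (f : Plane → α) (x v : Plane) : Prop :=
  ∃ U ∈ 𝓝 x, ∀ y ∈ U, ∀ s : ℝ, y + s • v ∈ U → f (y + s • v) = f y

/-- Points in the interior of a face: `f` is locally constant. -/
def facePoints {α : Type*} (f : Plane → α) : Set Plane := {x | ∀ᶠ y in 𝓝 x, f y = f x}

/-- Points in the interior of a straight edge: `f` is not locally constant, but locally it is
invariant in some direction (the direction of the edge). -/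
def edgePoints {α : Type*} (f : Plane → α) : Set Plane :=
  {x | x ∉ facePoints f ∧ ∃ v : Plane, v ≠ 0 ∧ LocInvariant f x v}

/-- Vertices: `f` is locally invariant in no direction at all. -/
def vertexPoints {α : Type*} (f : Plane → α) : Set Plane :=
  {x | ∀ v : Plane, v ≠ 0 → ¬ LocInvariant f x v}

/-- The connected components of a set. -/
def componentsOf (S : Set Plane) : Set (Set Plane) := {C | ∃ x ∈ S, C = connectedComponentIn S x}

namespace Terrain

/-- The labelling `χ` refined by the terrain itself: two points are told apart also if they do not
lie on the same triangles. Outside the domain the set of triangles is empty. -/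
def refine {α : Type*} (T : Terrain) (χ : Plane → α) (u : Plane) : Set (Finset Plane) × α :=
  ({t | t ∈ T.triangles ∧ u ∈ convexHull ℝ (t : Set Plane)}, χ u)

/-- The complexity of the subdivision of the terrain `T` into regions of constant label `χ`: its
number of vertices, edges and faces. Vertices and edges of the terrain, and points where a region
boundary crosses a terrain edge, count. -/
noncomputable def complexity {α : Type*} (T : Terrain) (χ : Plane → α) : ℕ∞ :=
  (vertexPoints (T.refine χ) ∩ T.domain).encard +
  (componentsOf (edgePoints (T.refine χ) ∩ T.domain)).encard +
  (componentsOf (facePoints (T.refine χ) ∩ T.domain)).encard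

/-- Visibility map: is the point visible from at least one viewpoint? -/
def visMap (T : Terrain) (P : Finset Plane) (u : Plane) : Prop := u ∈ T.viewshedOf P

/-- Colored visibility map: which viewpoints see the point? -/
def colVisMap (T : Terrain) (P : Finset Plane) (u : Plane) : Set Plane :=
  {p | p ∈ P ∧ u ∈ T.viewshed p}

/-- Voronoi visibility map: in the Voronoi viewsheds of which viewpoints is the point?
(More than one in case of ties, none if the point is invisible.) -/
def vorVisMap (T : Terrain) (P : Finset Plane) (u : Plane) : Set Plane :=
  {p | p ∈ P ∧ u ∈ T.voronoiViewshed P p}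

end Terrain

/-! Take a large flat triangle at height 0 and erect along the `x`-axis a comb of low, very thin
teeth, with gaps of width `2 * combGap` centred at `0, m, 2m, …`. Put about half of the viewpoints
far to the left and half far to the right, at depth `y = -1` and at distance 1 from each other.
Surface and viewpoints have height 0 away from the teeth, so visibility is a planar question: a
sight line that runs over a tooth is blocked. Behind the comb a viewpoint sees the whole line
through the middle of each gap (`IsComb.sees_of_line`), and hardly more than that: the line on which
a fictitious viewpoint halfway between two real ones would look through the gap is invisible to its
whole family (`IsComb.eventually_not_sees`).

The left family thus gives order of `m * n` visible rays, and the right family as many that lean the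
other way. Each invisible line of one family, through a gap of the left half of the comb, crosses
each invisible line of the other, through a gap of the right half. These order of `m ^ 2 * n ^ 2`
crossing points have unseen neighbourhoods and are pairwise separated by visible lines
(`IsComb.separated`), so they lie in different faces. Only these faces are counted, and since "seen
by nobody" is a single label in all three maps, one estimate serves all of them
(`Terrain.card_le_complexity`).

For `m = 1` there is no second family. Its role is taken by terrain edges: long slivers from the
base of the comb to a far corner cut the strips between the rays into order of `n ^ 2` pieces.

The terrain itself arises from one triangle by repeated insertion of a vertex into a triangle,
possibly raising it (`Terrain.exists_split`); this keeps all the axioms of a triangulation. -/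

/-! ### Barycentric coordinates and the subdivision of a triangle -/

/-- `l` is a system of barycentric coordinates with respect to the points of `t`. -/
structure IsBary (t : Finset Plane) (l : Plane → Plane → ℝ) : Prop where
  aff : ∀ v, ∃ a b c : ℝ, ∀ u, l v u = a * u.1 + b * u.2 + c
  sum_one : ∀ u, ∑ v ∈ t, l v u = 1
  sum_smul : ∀ u, ∑ v ∈ t, l v u • v = u
  delta : ∀ v ∈ t, ∀ w ∈ t, l v w = if v = w then 1 else 0

/-- The points with positive weights at all points of `t`. -/
def openCell (t : Finset Plane) : Set Plane :=
  {u | ∃ w : Plane → ℝ, (∀ v ∈ t, 0 < w v) ∧ ∑ v ∈ t, w v = 1 ∧ ∑ v ∈ t, w v • v = u}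

theorem affineMap_plane_eq (f : Plane →ᵃ[ℝ] ℝ) :
    ∃ a b c : ℝ, ∀ u, f u = a * u.1 + b * u.2 + c := by
  refine ⟨f.linear (1, 0), f.linear (0, 1), f 0, fun u => ?_⟩
  have h1 : f u = f.linear u + f 0 := by
    have := f.map_vadd 0 u
    simpa using this
  have h2 : u = u.1 • ((1, 0) : Plane) + u.2 • ((0, 1) : Plane) := by
    ext <;> simp
  have h3 : f.linear u = u.1 * f.linear (1, 0) + u.2 * f.linear (0, 1) := by
    conv_lhs => rw [h2]
    rw [map_add, map_smul, map_smul]; simp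
  rw [h1, h3]; ring

theorem exists_isBary {t : Finset Plane} (hc : t.card = 3)
    (hi : AffineIndependent ℝ (fun v : t => (v : Plane))) : ∃ l, IsBary t l := by
  classical
  have hspan : affineSpan ℝ (Set.range (fun v : t => (v : Plane))) = ⊤ := by
    rw [hi.affineSpan_eq_top_iff_card_eq_finrank_add_one]
    simp [hc]
  let b : AffineBasis t ℝ Plane := ⟨fun v => (v : Plane), hi, hspan⟩
  refine ⟨fun v u => if h : v ∈ t then b.coord ⟨v, h⟩ u else 0, ?_, ?_, ?_, ?_⟩
  · intro v
    by_cases h : v ∈ t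
    · simpa [h] using affineMap_plane_eq (b.coord ⟨v, h⟩)
    · exact ⟨0, 0, 0, by simp [h]⟩
  · intro u
    rw [← b.sum_coord_apply_eq_one u, ← Finset.sum_coe_sort t]
    refine Finset.sum_congr rfl fun v _ => ?_
    simp
  · intro u
    conv_rhs => rw [← b.linear_combination_coord_eq_self u]
    rw [← Finset.sum_coe_sort t]
    refine Finset.sum_congr rfl fun v _ => ?_
    simp only [v.2, dite_true]
    rfl
  · intro v hv w hw
    have := b.coord_apply ⟨v, hv⟩ ⟨w, hw⟩
    simp only [hv, dite_true]
    refine Eq.trans this ?_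
    simp

namespace IsBary

variable {t : Finset Plane} {l : Plane → Plane → ℝ}

theorem apply_sum (h : IsBary t l) {s : Finset Plane} (hs : s ⊆ t) (w : Plane → ℝ)
    (hw : ∑ v ∈ s, w v = 1) {v : Plane} (hv : v ∈ t) :
    l v (∑ x ∈ s, w x • x) = if v ∈ s then w v else 0 := by
  obtain ⟨a, b, c, habc⟩ := h.aff v
  have h1 : l v (∑ x ∈ s, w x • x) = ∑ x ∈ s, w x * l v x := by
    rw [habc]
    simp only [habc, Prod.fst_sum, Prod.snd_sum, Prod.smul_fst, Prod.smul_snd, smul_eq_mul]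
    rw [Finset.mul_sum, Finset.mul_sum]
    conv_lhs => rw [← mul_one c, ← hw, Finset.mul_sum]
    rw [← Finset.sum_add_distrib, ← Finset.sum_add_distrib]
    exact Finset.sum_congr rfl fun x _ => by ring
  rw [h1]
  have h2 : ∀ x ∈ s, w x * l v x = if v = x then w v else 0 := by
    intro x hx
    rw [h.delta v hv x (hs hx)]
    split_ifs with hvx <;> simp [hvx]
  rw [Finset.sum_congr rfl h2, Finset.sum_ite_eq]

theorem mem_openCell (h : IsBary t l) {u : Plane} :
    u ∈ openCell t ↔ ∀ v ∈ t, 0 < l v u := by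
  constructor
  · rintro ⟨w, hw, h1, rfl⟩ v hv
    rw [h.apply_sum subset_rfl w h1 hv, if_pos hv]
    exact hw v hv
  · intro hu
    exact ⟨fun v => l v u, hu, h.sum_one u, h.sum_smul u⟩

theorem mem_convexHull (h : IsBary t l) {s : Finset Plane} (hs : s ⊆ t) {u : Plane} :
    u ∈ convexHull ℝ (s : Set Plane) ↔ (∀ v ∈ t, 0 ≤ l v u) ∧ ∀ v ∈ t, v ∉ s → l v u = 0 := by
  constructor
  · intro hu
    rw [Finset.mem_convexHull'] at hu
    obtain ⟨w, hw, h1, rfl⟩ := hu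
    refine ⟨fun v hv => ?_, fun v hv hvs => ?_⟩
    · rw [h.apply_sum hs w h1 hv]
      split_ifs with hvs
      · exact hw v hvs
      · exact le_rfl
    · rw [h.apply_sum hs w h1 hv, if_neg hvs]
  · rintro ⟨h0, h1⟩
    rw [Finset.mem_convexHull']
    refine ⟨fun v => l v u, fun v hv => h0 v (hs hv), ?_, ?_⟩
    · rw [← h.sum_one u]
      exact Finset.sum_subset hs fun v hv hvs => h1 v hv hvs
    · conv_rhs => rw [← h.sum_smul u]
      exact Finset.sum_subset hs fun v hv hvs => by
        simp only [h1 v hv hvs, zero_smul]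

theorem mem_convexHull_self (h : IsBary t l) {u : Plane} :
    u ∈ convexHull ℝ (t : Set Plane) ↔ ∀ v ∈ t, 0 ≤ l v u := by
  rw [h.mem_convexHull subset_rfl]
  exact ⟨fun h => h.1, fun h => ⟨h, fun v hv hv' => absurd hv hv'⟩⟩

theorem continuous (h : IsBary t l) (v : Plane) : Continuous (l v) := by
  obtain ⟨a, b, c, habc⟩ := h.aff v
  have : l v = fun u => a * u.1 + b * u.2 + c := funext habc
  rw [this]; fun_prop

theorem isOpen_openCell (h : IsBary t l) : IsOpen (openCell t) := by
  have : openCell t = ⋂ v ∈ t, {u | 0 < l v u} := by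
    ext u; simp [h.mem_openCell]
  rw [this]
  exact isOpen_biInter_finset fun v _ => isOpen_lt continuous_const (h.continuous v)

theorem affineIndependent (h : IsBary t l) : AffineIndependent ℝ (fun v : t => (v : Plane)) := by
  rw [affineIndependent_iff]
  intro s w hw0 hw1 i hi
  obtain ⟨a, b, c, habc⟩ := h.aff i
  have h1 : ∑ e ∈ s, w e * l i e = 0 := by
    have e1 : ∑ e ∈ s, w e * (e : Plane).1 = 0 := by
      have := congrArg Prod.fst hw1
      simpa [Prod.fst_sum] using this
    have e2 : ∑ e ∈ s, w e * (e : Plane).2 = 0 := by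
      have := congrArg Prod.snd hw1
      simpa [Prod.snd_sum] using this
    have : ∑ e ∈ s, w e * l i e = a * ∑ e ∈ s, w e * (e : Plane).1 +
        b * ∑ e ∈ s, w e * (e : Plane).2 + c * ∑ e ∈ s, w e := by
      rw [Finset.mul_sum, Finset.mul_sum, Finset.mul_sum, ← Finset.sum_add_distrib,
        ← Finset.sum_add_distrib]
      exact Finset.sum_congr rfl fun x _ => by rw [habc]; ring
    rw [this, e1, e2, hw0]; simp
  have h2 : ∀ e ∈ s, w e * l i e = if i = e then w i else 0 := by
    intro e _
    rw [h.delta i i.2 e e.2]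
    by_cases hie : i = e
    · subst hie; simp
    · have : (i : Plane) ≠ e := fun h => hie (Subtype.ext h)
      simp [hie, this]
  rw [Finset.sum_congr rfl h2, Finset.sum_ite_eq, if_pos hi] at h1
  exact h1

end IsBary

theorem openCell_subset_convexHull (t : Finset Plane) :
    openCell t ⊆ convexHull ℝ (t : Set Plane) := by
  rintro u ⟨w, hw, h1, hu⟩
  rw [Finset.mem_convexHull']
  exact ⟨w, fun v hv => (hw v hv).le, h1, hu⟩

theorem mem_openCell_triple {x y z : Plane} (hxy : x ≠ y) (hxz : x ≠ z) (hyz : y ≠ z) {u : Plane}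
    {a b c : ℝ} (ha : 0 < a) (hb : 0 < b) (hc : 0 < c) (h1 : a + b + c = 1)
    (hu1 : a * x.1 + b * y.1 + c * z.1 = u.1) (hu2 : a * x.2 + b * y.2 + c * z.2 = u.2) :
    u ∈ openCell {x, y, z} := by
  refine ⟨fun v => if v = x then a else if v = y then b else c, ?_, ?_, ?_⟩
  · intro v _
    dsimp only
    split_ifs <;> assumption
  · rw [Finset.sum_insert (by simp [hxy, hxz]), Finset.sum_pair hyz]
    simp [hxy.symm, hxz.symm, hyz.symm]; linarith
  · rw [Finset.sum_insert (by simp [hxy, hxz]), Finset.sum_pair hyz]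
    simp only [hxy.symm, hxz.symm, hyz.symm, if_true, if_false]
    ext
    · simp; linarith
    · simp; linarith

/-- The triangle that arises from `t` by replacing its corner `v` with `p`. -/
noncomputable def subTriangle (t : Finset Plane) (p v : Plane) : Finset Plane := insert p (t.erase v)

theorem subTriangle_subset_insert (t : Finset Plane) (p v : Plane) :
    subTriangle t p v ⊆ insert p t :=
  Finset.insert_subset_insert _ (Finset.erase_subset _ _)

namespace IsBary

variable {t : Finset Plane} {l : Plane → Plane → ℝ}

theorem notMem_of_mem_openCell (h : IsBary t l) (hc : t.card = 3) {p : Plane}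
    (hp : p ∈ openCell t) : p ∉ t := by
  intro hpt
  have : (t.erase p).Nonempty := by
    rw [← Finset.card_pos, Finset.card_erase_of_mem hpt]; omega
  obtain ⟨w, hw⟩ := this
  rw [Finset.mem_erase] at hw
  have h1 := (h.mem_openCell.1 hp) w hw.2
  rw [h.delta w hw.2 p hpt, if_neg hw.1] at h1
  exact lt_irrefl _ h1

/-- Barycentric coordinates of the triangle in which the corner `v` is replaced with `p`. -/
theorem subTriangle (h : IsBary t l) {p v : Plane} (hv : v ∈ t) (hp : p ∉ t) (hvp : 0 < l v p) :
    IsBary (subTriangle t p v)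
      (fun x u => if x = p then l v u / l v p else l x u - l v u / l v p * l x p) := by
  have hpe : p ∉ t.erase v := fun h => hp (Finset.mem_of_mem_erase h)
  have hne : ∀ x ∈ t.erase v, x ≠ p := fun x hx hxp => hpe (hxp ▸ hx)
  refine ⟨fun x => ?_, fun u => ?_, fun u => ?_, fun x hx y hy => ?_⟩
  · obtain ⟨a, b, c, h1⟩ := h.aff v
    obtain ⟨a', b', c', h2⟩ := h.aff x
    by_cases hxp : x = p
    · refine ⟨a / l v p, b / l v p, c / l v p, fun u => ?_⟩
      simp only [hxp, if_true, h1 u]; ring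
    · refine ⟨a' - a / l v p * l x p, b' - b / l v p * l x p, c' - c / l v p * l x p, fun u => ?_⟩
      simp only [hxp, if_false, h1 u, h2 u]; ring
  · rw [_root_.subTriangle, Finset.sum_insert hpe, if_pos rfl,
      Finset.sum_congr rfl (fun x hx => if_neg (hne x hx)), Finset.sum_sub_distrib,
      ← Finset.mul_sum, Finset.sum_erase_eq_sub hv, Finset.sum_erase_eq_sub hv, h.sum_one,
      h.sum_one]
    field_simp; ring
  · rw [_root_.subTriangle, Finset.sum_insert hpe, if_pos rfl]
    have : ∀ x ∈ t.erase v, (if x = p then l v u / l v p else l x u - l v u / l v p * l x p) • x =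
        l x u • x - (l v u / l v p) • (l x p • x) := by
      intro x hx
      rw [if_neg (hne x hx), sub_smul, mul_smul]
    rw [Finset.sum_congr rfl this, Finset.sum_sub_distrib, ← Finset.smul_sum,
      Finset.sum_erase_eq_sub hv, Finset.sum_erase_eq_sub hv, h.sum_smul, h.sum_smul, smul_sub,
      smul_smul, div_mul_cancel₀ _ hvp.ne']
    abel
  · rw [_root_.subTriangle, Finset.mem_insert] at hx hy
    rcases hx with rfl | hx <;> rcases hy with rfl | hy
    · rw [if_pos rfl, if_pos rfl, div_self hvp.ne']
    · rw [if_pos rfl, if_neg (hne y hy).symm, h.delta v hv y (Finset.mem_of_mem_erase hy),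
        if_neg (Finset.ne_of_mem_erase hy).symm, zero_div]
    · rw [if_neg (hne x hx), if_neg (hne x hx), div_self hvp.ne', one_mul, sub_self]
    · rw [if_neg (hne x hx), h.delta v hv y (Finset.mem_of_mem_erase hy),
        if_neg (Finset.ne_of_mem_erase hy).symm, zero_div, zero_mul, sub_zero,
        h.delta x (Finset.mem_of_mem_erase hx) y (Finset.mem_of_mem_erase hy)]

/-- The part of `t` opposite the corner `v` is where the ratio `l v u / l v p` is smallest among the
corners. This description yields covering, overlap and the tent function of the subdivision. -/
theorem mem_convexHull_subTriangle (h : IsBary t l) (hc : t.card = 3) {p v : Plane} (hv : v ∈ t)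
    (hp : p ∈ openCell t) {u : Plane} :
    u ∈ convexHull ℝ (_root_.subTriangle t p v : Set Plane) ↔
      0 ≤ l v u / l v p ∧ ∀ x ∈ t, l v u / l v p ≤ l x u / l x p := by
  have hpt := h.notMem_of_mem_openCell hc hp
  have hpos := h.mem_openCell.1 hp
  rw [(h.subTriangle hv hpt (hpos v hv)).mem_convexHull_self, _root_.subTriangle,
    Finset.forall_mem_insert, if_pos rfl]
  refine and_congr_right fun _ => ⟨fun H x hx => ?_, fun H x hx => ?_⟩
  · by_cases hxv : x = v
    · rw [hxv]
    · have := H x (Finset.mem_erase.2 ⟨hxv, hx⟩)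
      rw [if_neg (fun hxp : x = p => hpt (hxp ▸ hx))] at this
      rw [le_div_iff₀ (hpos x hx)]; linarith
  · have hxt := Finset.mem_of_mem_erase hx
    rw [if_neg (fun hxp : x = p => hpt (hxp ▸ hxt))]
    have := H x hxt
    rw [le_div_iff₀ (hpos x hxt)] at this; linarith

theorem convexHull_subTriangle_subset (h : IsBary t l) (hc : t.card = 3) {p v : Plane} (hv : v ∈ t)
    (hp : p ∈ openCell t) :
    convexHull ℝ (_root_.subTriangle t p v : Set Plane) ⊆ convexHull ℝ (t : Set Plane) := by
  intro u hu
  rw [h.mem_convexHull_subTriangle hc hv hp] at hu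
  rw [h.mem_convexHull_self]
  intro x hx
  have := hu.1.trans (hu.2 x hx)
  have hx0 := h.mem_openCell.1 hp x hx
  by_contra hneg
  exact absurd this (not_le.2 (div_neg_of_neg_of_pos (not_le.1 hneg) hx0))

theorem exists_mem_subTriangle (h : IsBary t l) (hc : t.card = 3) {p : Plane}
    (hp : p ∈ openCell t) {u : Plane} (hu : u ∈ convexHull ℝ (t : Set Plane)) :
    ∃ v ∈ t, u ∈ convexHull ℝ (_root_.subTriangle t p v : Set Plane) := by
  obtain ⟨v, hv, hmin⟩ := t.exists_min_image (fun x => l x u / l x p)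
    (Finset.card_pos.1 (by omega))
  refine ⟨v, hv, (h.mem_convexHull_subTriangle hc hv hp).2 ⟨?_, hmin⟩⟩
  exact div_nonneg (h.mem_convexHull_self.1 hu v hv) (h.mem_openCell.1 hp v hv).le

/-- On the overlap the ratios at `v` and `w` are both minimal, hence equal, which makes the
coordinate of the only unshared corner `w` vanish. -/
theorem subTriangle_face_to_face (h : IsBary t l) (hc : t.card = 3) {p v w : Plane} (hv : v ∈ t)
    (hw : w ∈ t) (hp : p ∈ openCell t) :
    convexHull ℝ (_root_.subTriangle t p v : Set Plane) ∩
        convexHull ℝ (_root_.subTriangle t p w : Set Plane) ⊆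
      convexHull ℝ ((_root_.subTriangle t p v : Set Plane) ∩
        (_root_.subTriangle t p w : Set Plane)) := by
  rintro u ⟨h1, h2⟩
  have hpt := h.notMem_of_mem_openCell hc hp
  have hpos := h.mem_openCell.1 hp
  have hb := h.subTriangle hv hpt (hpos v hv)
  have h1' := (h.mem_convexHull_subTriangle hc hv hp).1 h1
  have h2' := (h.mem_convexHull_subTriangle hc hw hp).1 h2
  rw [← Finset.coe_inter, hb.mem_convexHull Finset.inter_subset_left]
  refine ⟨hb.mem_convexHull_self.1 h1, fun x hx hxn => ?_⟩
  have hxw : x ∉ _root_.subTriangle t p w := fun h => hxn (Finset.mem_inter.2 ⟨hx, h⟩)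
  rw [_root_.subTriangle, Finset.mem_insert, Finset.mem_erase] at hx hxw
  push Not at hxw
  rw [if_neg hxw.1]
  obtain ⟨-, hxt⟩ := hx.resolve_left hxw.1
  have hxw' : x = w := by
    by_contra hne
    exact hxw.2 hne hxt
  subst hxw'
  have := le_antisymm (h1'.2 x hxt) (h2'.2 v hv)
  rw [this, div_mul_cancel₀ _ (hpos x hxt).ne', sub_self]

/-- A different triangle `s` misses a corner `w` of `t`, so a common point has ratio 0 at `w`. The
minimal ratio is then 0 too, and the point lies on the side opposite `v`, which the subdivision
leaves intact. -/
theorem subTriangle_face_to_face_of (h : IsBary t l) (hc : t.card = 3) {s : Finset Plane}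
    (hs : s.card = 3) (hst : s ≠ t) (hf : convexHull ℝ (s : Set Plane) ∩ convexHull ℝ (t : Set Plane) ⊆
      convexHull ℝ ((s : Set Plane) ∩ (t : Set Plane))) {p v : Plane} (hv : v ∈ t)
    (hp : p ∈ openCell t) :
    convexHull ℝ (s : Set Plane) ∩ convexHull ℝ (_root_.subTriangle t p v : Set Plane) ⊆
      convexHull ℝ ((s : Set Plane) ∩ (_root_.subTriangle t p v : Set Plane)) := by
  rintro u ⟨h1, h2⟩
  have hpos := h.mem_openCell.1 hp
  have hut := h.convexHull_subTriangle_subset hc hv hp h2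
  have h3 := hf ⟨h1, hut⟩
  rw [← Finset.coe_inter, h.mem_convexHull Finset.inter_subset_right] at h3
  obtain ⟨w, hwt, hws⟩ : ∃ w ∈ t, w ∉ s := by
    by_contra hcon
    push Not at hcon
    exact hst (Finset.eq_of_subset_of_card_le hcon (by omega)).symm
  have hw0 : l w u = 0 := h3.2 w hwt (fun h => hws (Finset.mem_inter.1 h).1)
  have h2' := (h.mem_convexHull_subTriangle hc hv hp).1 h2
  have hv0 : l v u = 0 := by
    have h4 := h2'.2 w hwt
    rw [hw0, zero_div] at h4
    have h5 := le_antisymm h4 h2'.1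
    rcases div_eq_zero_iff.1 h5 with h6 | h6
    · exact h6
    · exact absurd h6 (hpos v hv).ne'
  have h4 : u ∈ convexHull ℝ ((s ∩ t.erase v : Finset Plane) : Set Plane) := by
    rw [h.mem_convexHull (Finset.inter_subset_right.trans (Finset.erase_subset _ _))]
    refine ⟨h3.1, fun x hx hxn => ?_⟩
    by_cases hxv : x = v
    · rw [hxv, hv0]
    · refine h3.2 x hx fun hxs => hxn ?_
      exact Finset.mem_inter.2 ⟨(Finset.mem_inter.1 hxs).1, Finset.mem_erase.2 ⟨hxv, hx⟩⟩
  refine convexHull_mono ?_ h4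
  rw [← Finset.coe_inter, Finset.coe_subset]
  exact Finset.inter_subset_inter subset_rfl (Finset.subset_insert _ _)

end IsBary

/-! ### Insertion of a vertex into a terrain -/

namespace Terrain

theorem exists_bary (T : Terrain) {t : Finset Plane} (ht : t ∈ T.triangles) : ∃ l, IsBary t l :=
  exists_isBary (T.triangle_card t ht) (T.triangle_indep t ht)

theorem eq_of_mem_openCell (T : Terrain) {s t : Finset Plane} (hs : s ∈ T.triangles)
    (ht : t ∈ T.triangles) {u : Plane} (hu : u ∈ openCell t)
    (hus : u ∈ convexHull ℝ (s : Set Plane)) : s = t := by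
  obtain ⟨l, hl⟩ := T.exists_bary ht
  have h1 := T.face_to_face s hs t ht ⟨hus, openCell_subset_convexHull t hu⟩
  rw [← Finset.coe_inter, hl.mem_convexHull Finset.inter_subset_right] at h1
  have hts : t ⊆ s := by
    intro v hv
    by_contra hvs
    have := h1.2 v hv (fun h => hvs (Finset.mem_inter.1 h).1)
    exact absurd this (hl.mem_openCell.1 hu v hv).ne'
  exact (Finset.eq_of_subset_of_card_le hts (by rw [T.triangle_card s hs, T.triangle_card t ht])).symm

theorem notMem_vertices_of_mem_openCell (T : Terrain) {t : Finset Plane} (ht : t ∈ T.triangles)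
    {p : Plane} (hp : p ∈ openCell t) : p ∉ T.vertices := by
  intro hv
  obtain ⟨s, hs, hps⟩ := T.vertex_mem p hv
  have h1 := T.eq_of_mem_openCell hs ht hp (subset_convexHull ℝ _ hps)
  obtain ⟨l, hl⟩ := T.exists_bary ht
  exact hl.notMem_of_mem_openCell (T.triangle_card t ht) hp (h1 ▸ hps)

/-- Insertion of a new vertex `p` in the interior of the triangle `t`, which is thereby raised to
`c` above the surface. -/
theorem exists_split (T : Terrain) {t : Finset Plane} (ht : t ∈ T.triangles) {p : Plane}
    (hp : p ∈ openCell t) (c : ℝ) :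
    ∃ (T' : Terrain) (φ : Plane → ℝ), T'.vertices = insert p T.vertices ∧
      T'.triangles = T.triangles.erase t ∪ t.image (subTriangle t p) ∧
      T'.domain = T.domain ∧ (∀ u, T'.height u = T.height u + c * φ u) ∧
      (∀ u ∈ openCell t, 0 < φ u) ∧ ∀ u ∉ openCell t, φ u = 0 := by
  obtain ⟨l, hl⟩ := T.exists_bary ht
  have hc := T.triangle_card t ht
  have hne : t.Nonempty := Finset.card_pos.1 (by omega)
  have hpos := hl.mem_openCell.1 hp
  have hpt := hl.notMem_of_mem_openCell hc hp
  -- The tent over `t` with value 1 at `p`: the minimal ratio is linear on each part, and the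
  -- truncation at 0 extends it beyond `t`.
  set φ : Plane → ℝ := fun u => max 0 (t.inf' hne fun x => l x u / l x p) with hφ
  have hφpos : ∀ u ∈ openCell t, 0 < φ u := by
    intro u hu
    refine lt_max_of_lt_right ((Finset.lt_inf'_iff hne).2 fun x hx => ?_)
    exact div_pos (hl.mem_openCell.1 hu x hx) (hpos x hx)
  have hφ0 : ∀ u ∉ openCell t, φ u = 0 := by
    intro u hu
    rw [hl.mem_openCell] at hu
    push Not at hu
    obtain ⟨x, hx, hx0⟩ := hu
    refine max_eq_left ((Finset.inf'_le _ hx).trans ?_)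
    exact div_nonpos_of_nonpos_of_nonneg hx0 (hpos x hx).le
  have hφv : ∀ v ∈ t, ∀ u ∈ convexHull ℝ (subTriangle t p v : Set Plane),
      φ u = l v u / l v p := by
    intro v hv u hu
    rw [hl.mem_convexHull_subTriangle hc hv hp] at hu
    rw [hφ]
    dsimp only
    rw [le_antisymm (Finset.inf'_le _ hv) (Finset.le_inf' hne _ hu.2), max_eq_right hu.1]
  have hmem : ∀ s, s ∈ T.triangles.erase t ∪ t.image (subTriangle t p) ↔
      (s ≠ t ∧ s ∈ T.triangles) ∨ ∃ v ∈ t, subTriangle t p v = s := by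
    intro s; simp
  have hdom : (⋃ s ∈ T.triangles.erase t ∪ t.image (subTriangle t p), convexHull ℝ (s : Set Plane))
      = ⋃ s ∈ T.triangles, convexHull ℝ (s : Set Plane) := by
    ext u
    simp only [Set.mem_iUnion, exists_prop]
    constructor
    · rintro ⟨s, hs, hu⟩
      rcases (hmem s).1 hs with ⟨_, hs⟩ | ⟨v, hv, rfl⟩
      · exact ⟨s, hs, hu⟩
      · exact ⟨t, ht, hl.convexHull_subTriangle_subset hc hv hp hu⟩
    · rintro ⟨s, hs, hu⟩
      by_cases hst : s = t
      · subst hst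
        obtain ⟨v, hv, huv⟩ := hl.exists_mem_subTriangle hc hp hu
        exact ⟨_, (hmem _).2 (Or.inr ⟨v, hv, rfl⟩), huv⟩
      · exact ⟨s, (hmem _).2 (Or.inl ⟨hst, hs⟩), hu⟩
  refine ⟨{
    vertices := insert p T.vertices
    triangles := T.triangles.erase t ∪ t.image (subTriangle t p)
    height := fun u => T.height u + c * φ u
    triangles_nonempty := ?_
    triangle_subset := ?_
    triangle_card := ?_
    triangle_indep := ?_
    vertex_mem := ?_
    face_to_face := ?_
    convex_domain := ?_
    height_affine := ?_ }, φ, rfl, rfl, hdom, fun _ => rfl, hφpos, hφ0⟩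
  · obtain ⟨v, hv⟩ := hne
    exact ⟨_, (hmem _).2 (Or.inr ⟨v, hv, rfl⟩)⟩
  · intro s hs
    rcases (hmem s).1 hs with ⟨_, hs⟩ | ⟨v, hv, rfl⟩
    · exact (T.triangle_subset s hs).trans (Finset.subset_insert _ _)
    · exact (subTriangle_subset_insert t p v).trans
        (Finset.insert_subset_insert _ (T.triangle_subset t ht))
  · intro s hs
    rcases (hmem s).1 hs with ⟨_, hs⟩ | ⟨v, hv, rfl⟩
    · exact T.triangle_card s hs
    · rw [subTriangle, Finset.card_insert_of_notMem (fun h => hpt (Finset.mem_of_mem_erase h)),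
        Finset.card_erase_of_mem hv, hc]
  · intro s hs
    rcases (hmem s).1 hs with ⟨_, hs⟩ | ⟨v, hv, rfl⟩
    · exact T.triangle_indep s hs
    · exact (hl.subTriangle hv hpt (hpos v hv)).affineIndependent
  · intro x hx
    have key : x ∈ insert p t → ∃ s ∈ T.triangles.erase t ∪ t.image (subTriangle t p), x ∈ s := by
      intro hx
      rcases Finset.mem_insert.1 hx with rfl | hx
      · obtain ⟨v, hv⟩ := hne
        exact ⟨_, (hmem _).2 (Or.inr ⟨v, hv, rfl⟩), Finset.mem_insert_self _ _⟩
      · obtain ⟨v, hv, hvx⟩ : ∃ v ∈ t, v ≠ x := by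
          have : (t.erase x).Nonempty := by
            rw [← Finset.card_pos, Finset.card_erase_of_mem hx]; omega
          obtain ⟨v, hv⟩ := this
          exact ⟨v, Finset.mem_of_mem_erase hv, Finset.ne_of_mem_erase hv⟩
        exact ⟨_, (hmem _).2 (Or.inr ⟨v, hv, rfl⟩),
          Finset.mem_insert_of_mem (Finset.mem_erase.2 ⟨hvx.symm, hx⟩)⟩
    rcases Finset.mem_insert.1 hx with rfl | hx
    · exact key (Finset.mem_insert_self _ _)
    · obtain ⟨s, hs, hxs⟩ := T.vertex_mem x hx
      by_cases hst : s = t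
      · exact key (Finset.mem_insert_of_mem (hst ▸ hxs))
      · exact ⟨s, (hmem _).2 (Or.inl ⟨hst, hs⟩), hxs⟩
  · intro s hs s' hs'
    rcases (hmem s).1 hs with ⟨hst, hs⟩ | ⟨v, hv, rfl⟩ <;>
      rcases (hmem s').1 hs' with ⟨hst', hs'⟩ | ⟨w, hw, rfl⟩
    · exact T.face_to_face s hs s' hs'
    · exact hl.subTriangle_face_to_face_of hc (T.triangle_card s hs) hst
        (T.face_to_face s hs t ht) hw hp
    · rw [Set.inter_comm, Set.inter_comm (subTriangle t p v : Set Plane)]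
      exact hl.subTriangle_face_to_face_of hc (T.triangle_card s' hs') hst'
        (T.face_to_face s' hs' t ht) hv hp
    · exact hl.subTriangle_face_to_face hc hv hw hp
  · rw [hdom]; exact T.convex_domain
  · intro s hs
    rcases (hmem s).1 hs with ⟨hst, hs⟩ | ⟨v, hv, rfl⟩
    · obtain ⟨a, b, d, h⟩ := T.height_affine s hs
      refine ⟨a, b, d, fun u hu => ?_⟩
      -- The other triangles miss the open cell of `t`, so the tent vanishes on them.
      have : u ∉ openCell t := fun hut => hst (T.eq_of_mem_openCell hs ht hut hu)
      rw [hφ0 u this, h u hu]; ring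
    · obtain ⟨a, b, d, h⟩ := T.height_affine t ht
      obtain ⟨a', b', d', h'⟩ := hl.aff v
      refine ⟨a + c * (a' / l v p), b + c * (b' / l v p), d + c * (d' / l v p), fun u hu => ?_⟩
      rw [hφv v hv u hu, h u (hl.convexHull_subTriangle_subset hc hv hp hu), h' u]; ring

end Terrain

/-! ### Lower bounds for the number of faces -/

theorem eq_of_isPreconnected_facePoints {α : Type*} {f : Plane → α} {C : Set Plane}
    (hC : IsPreconnected C) (hf : C ⊆ facePoints f) {x y : Plane} (hx : x ∈ C) (hy : y ∈ C) :
    f y = f x := by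
  have h1 : IsOpen {y | ∀ᶠ z in 𝓝 y, f z = f x} := isOpen_setOfPred_eventually_nhds
  have h2 : IsOpen {y | ∀ᶠ z in 𝓝 y, f z ≠ f x} := isOpen_setOfPred_eventually_nhds
  have h3 := hC.subset_left_of_subset_union h1 h2 ?_ ?_ ⟨x, hx, hf hx⟩
  · exact (h3 hy).self_of_nhds
  · rw [Set.disjoint_left]
    intro z hz hz'
    exact hz'.self_of_nhds hz.self_of_nhds
  · intro z hz
    have h4 : ∀ᶠ w in 𝓝 z, f w = f z := hf hz
    by_cases hzx : f z = f x
    · left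
      exact h4.mono fun w hw => hw.trans hzx
    · right
      exact h4.mono fun w hw => hw ▸ hzx

namespace Terrain

/-- The two points lie in no common triangle, or on different sides of a curve in `V`. -/
def Separated (T : Terrain) (V : Set Plane) (u v : Plane) : Prop :=
  (∃ f : Plane → ℝ, Continuous f ∧ f u * f v < 0 ∧ ∀ w ∈ T.domain, f w = 0 → w ∈ V) ∨
    ∀ t ∈ T.triangles, u ∈ convexHull ℝ (t : Set Plane) → v ∉ convexHull ℝ (t : Set Plane)

theorem isClosed_convexHull_triangle (t : Finset Plane) :
    IsClosed (convexHull ℝ (t : Set Plane)) :=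
  (t.finite_toSet.isCompact_convexHull ℝ).isClosed

/-- Both alternatives are open conditions on the pair, so separated points may be perturbed. -/
theorem Separated.eventually {T : Terrain} {V : Set Plane} {u v : Plane} (h : T.Separated V u v) :
    ∃ U ∈ 𝓝 u, ∃ W ∈ 𝓝 v, ∀ u' ∈ U, ∀ v' ∈ W, T.Separated V u' v' := by
  have h1 : {p : Plane × Plane | T.Separated V p.1 p.2} ∈ 𝓝 (u, v) := by
    rcases h with ⟨f, hf, huv, hV⟩ | h
    · have h2 : IsOpen {p : Plane × Plane | f p.1 * f p.2 < 0} :=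
        isOpen_lt (by fun_prop) continuous_const
      exact Filter.mem_of_superset (h2.mem_nhds huv) fun p hp => Or.inl ⟨f, hf, hp, hV⟩
    · have h2 : IsOpen (⋂ t ∈ T.triangles,
          ((convexHull ℝ (t : Set Plane)) ×ˢ (convexHull ℝ (t : Set Plane)))ᶜ) :=
        isOpen_biInter_finset fun t _ =>
          ((isClosed_convexHull_triangle t).prod (isClosed_convexHull_triangle t)).isOpen_compl
      refine Filter.mem_of_superset (h2.mem_nhds ?_) fun p hp => Or.inr ?_
      · simp only [Set.mem_iInter]
        exact fun t ht h' => h t ht h'.1 h'.2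
      · simp only [Set.mem_iInter] at hp
        exact fun t ht h1 h2 => hp t ht ⟨h1, h2⟩
  obtain ⟨U, hU, W, hW, hUW⟩ := mem_nhds_prod_iff.1 h1
  exact ⟨U, hU, W, hW, fun u' hu' v' hv' => (hUW (Set.mk_mem_prod hu' hv') :)⟩

theorem dense_compl_frontiers (T : Terrain) :
    Dense {u : Plane | ∀ t ∈ T.triangles, u ∉ frontier (convexHull ℝ (t : Set Plane))} := by
  have h := dense_biInter_of_isOpen (S := (T.triangles : Set (Finset Plane)))
    (f := fun t => (frontier (convexHull ℝ (t : Set Plane)))ᶜ)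
    (fun _ _ => isClosed_frontier.isOpen_compl) T.triangles.finite_toSet.countable
    (fun t _ => by
      rw [← interior_eq_empty_iff_dense_compl]
      exact interior_frontier (isClosed_convexHull_triangle t))
  convert h using 1
  ext u; simp

theorem mem_facePoints_refine {α : Type*} (T : Terrain) {χ : Plane → α} {u : Plane}
    (hu : ∀ t ∈ T.triangles, u ∉ frontier (convexHull ℝ (t : Set Plane)))
    (hχ : ∀ᶠ v in 𝓝 u, χ v = χ u) : u ∈ facePoints (T.refine χ) := by
  have h1 : ∀ᶠ v in 𝓝 u, ∀ t ∈ T.triangles,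
      (v ∈ convexHull ℝ (t : Set Plane) ↔ u ∈ convexHull ℝ (t : Set Plane)) := by
    rw [Filter.eventually_all_finset]
    intro t ht
    by_cases hut : u ∈ convexHull ℝ (t : Set Plane)
    · have h2 : u ∈ interior (convexHull ℝ (t : Set Plane)) := by
        by_contra h
        exact hu t ht ⟨subset_closure hut, h⟩
      filter_upwards [isOpen_interior.mem_nhds h2] with v hv
      simp [hut, interior_subset hv]
    · filter_upwards [(isClosed_convexHull_triangle t).isOpen_compl.mem_nhds hut] with v hv
      exact iff_of_false hv hut
  filter_upwards [h1, hχ] with v hv hv'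
  refine Prod.ext (Set.ext fun t => ?_) hv'
  simp only [refine, Set.mem_ofPred_eq]
  exact and_congr_right fun ht => hv t ht

/-- Pairwise separated points with invisible neighbourhoods lie in different faces. -/
theorem card_le_complexity {α ι : Type*} [Finite ι] (T : Terrain) (V : Set Plane) {χ : Plane → α}
    {e : α} (hχ : ∀ u, χ u = e ↔ u ∉ V) (q : ι → Plane) (hq : ∀ x, q x ∈ interior T.domain)
    (hV : ∀ x, ∀ᶠ u in 𝓝 (q x), u ∉ V)
    (hsep : ∀ x y, x ≠ y → T.Separated V (q x) (q y)) :
    ENat.card ι ≤ T.complexity χ := by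
  have hsep' : ∀ x y, ∃ U ∈ 𝓝 (q x), ∃ W ∈ 𝓝 (q y), x ≠ y →
      ∀ u ∈ U, ∀ v ∈ W, T.Separated V u v := by
    intro x y
    by_cases hxy : x = y
    · exact ⟨_, Filter.univ_mem, _, Filter.univ_mem, fun h => absurd hxy h⟩
    · obtain ⟨U, hU, W, hW, h⟩ := (hsep x y hxy).eventually
      exact ⟨U, hU, W, hW, fun _ => h⟩
  choose U hU W hW hUW using hsep'
  -- The given points may lie on terrain edges, where the refined labelling is not locally constant;
  -- nearby points off all triangle boundaries replace them.
  have hr : ∀ x, ∃ r, (∀ y, r ∈ U x y ∧ r ∈ W y x) ∧ r ∈ T.domain ∧ (∀ᶠ u in 𝓝 r, u ∉ V) ∧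
      ∀ t ∈ T.triangles, r ∉ frontier (convexHull ℝ (t : Set Plane)) := by
    intro x
    have h1 : ∀ᶠ r in 𝓝 (q x), (∀ y, r ∈ U x y ∧ r ∈ W y x) ∧ r ∈ interior T.domain ∧
        ∀ᶠ u in 𝓝 r, u ∉ V := by
      refine Filter.Eventually.and ?_ (Filter.Eventually.and ?_ ?_)
      · rw [Filter.eventually_all]
        exact fun y => Filter.Eventually.and (hU x y) (hW y x)
      · exact isOpen_interior.mem_nhds (hq x)
      · exact eventually_eventually_nhds.2 (hV x)
    obtain ⟨r, hr1, hr2⟩ := T.dense_compl_frontiers.inter_nhds_nonempty h1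
    exact ⟨r, hr2.1, interior_subset hr2.2.1, hr2.2.2, hr1⟩
  choose r hrUW hrd hrV hrf using hr
  set F := facePoints (T.refine χ) ∩ T.domain with hF
  have hrF : ∀ x, r x ∈ F := by
    intro x
    refine ⟨T.mem_facePoints_refine (hrf x) ?_, hrd x⟩
    filter_upwards [hrV x] with v hv
    rw [(hχ v).2 hv, (hχ (r x)).2 (hrV x).self_of_nhds]
  have hinj : Function.Injective fun x => connectedComponentIn F (r x) := by
    intro x y hxy
    by_contra hne
    dsimp only at hxy
    set C := connectedComponentIn F (r x) with hC
    have hx : r x ∈ C := mem_connectedComponentIn (hrF x)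
    have hy : r y ∈ C := hxy ▸ mem_connectedComponentIn (hrF y)
    have hCF : C ⊆ F := connectedComponentIn_subset F (r x)
    have hpre : IsPreconnected C := isPreconnected_connectedComponentIn
    have hlab : ∀ u ∈ C, T.refine χ u = T.refine χ (r x) := fun u hu =>
      eq_of_isPreconnected_facePoints hpre (fun v hv => (hCF hv).1) hx hu
    rcases hUW x y hne _ (hrUW x y).1 _ (hrUW y x).2 with ⟨f, hf, hlt, hfV⟩ | h
    -- A face containing both points would meet the separating curve, which lies in `V`, although
    -- its label says "outside `V`".
    · have h0 : ∃ u ∈ C, f u = 0 := by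
        rcases mul_neg_iff.1 hlt with ⟨h1, h2⟩ | ⟨h1, h2⟩
        · obtain ⟨u, hu, hu0⟩ := hpre.intermediate_value hy hx hf.continuousOn
            (show (0 : ℝ) ∈ Set.Icc _ _ from ⟨h2.le, h1.le⟩)
          exact ⟨u, hu, hu0⟩
        · obtain ⟨u, hu, hu0⟩ := hpre.intermediate_value hx hy hf.continuousOn
            (show (0 : ℝ) ∈ Set.Icc _ _ from ⟨h1.le, h2.le⟩)
          exact ⟨u, hu, hu0⟩
      obtain ⟨u, hu, hu0⟩ := h0
      have h1 : χ u = χ (r x) := congrArg Prod.snd (hlab u hu)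
      rw [(hχ (r x)).2 (hrV x).self_of_nhds, hχ] at h1
      exact h1 (hfV u (hCF hu).2 hu0)
    · have hd := hrd x
      simp only [domain, Set.mem_iUnion, exists_prop] at hd
      obtain ⟨t, ht, hxt⟩ := hd
      have h1 : {t | t ∈ T.triangles ∧ r y ∈ convexHull ℝ (t : Set Plane)} =
          {t | t ∈ T.triangles ∧ r x ∈ convexHull ℝ (t : Set Plane)} :=
        congrArg Prod.fst (hlab (r y) hy)
      have h2 : t ∈ {t | t ∈ T.triangles ∧ r y ∈ convexHull ℝ (t : Set Plane)} := by
        rw [h1]; exact ⟨ht, hxt⟩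
      exact h t ht hxt h2.2
  -- Vertices and edges are dropped; faces alone give the bound.
  refine hinj.encard_range.trans (le_trans (Set.encard_le_encard ?_) le_add_self)
  rintro _ ⟨x, rfl⟩
  exact ⟨r x, hrF x, rfl⟩

theorem visMap_eq_false_iff (T : Terrain) (P : Finset Plane) (u : Plane) :
    T.visMap P u = False ↔ u ∉ T.viewshedOf P := by
  simp [visMap]

theorem colVisMap_eq_empty_iff (T : Terrain) (P : Finset Plane) (u : Plane) :
    T.colVisMap P u = ∅ ↔ u ∉ T.viewshedOf P := by
  simp [colVisMap, viewshedOf, Set.eq_empty_iff_forall_notMem]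

/-- Among the finitely many viewpoints that see a point, one is nearest; so no seen point gets the
empty label. -/
theorem vorVisMap_eq_empty_iff (T : Terrain) (P : Finset Plane) (u : Plane) :
    T.vorVisMap P u = ∅ ↔ u ∉ T.viewshedOf P := by
  classical
  rw [← not_iff_not, not_not, ← ne_eq, ← Set.nonempty_iff_ne_empty]
  simp only [viewshedOf, Set.mem_iUnion, exists_prop]
  constructor
  · rintro ⟨p, hp, hu, -⟩
    exact ⟨p, hp, hu⟩
  · rintro ⟨p, hp, hu⟩
    obtain ⟨p', hp', hmin⟩ := (P.filter fun p => u ∈ T.viewshed p).exists_min_image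
      (fun p => euclDist (T.lift p) (T.lift u)) ⟨p, Finset.mem_filter.2 ⟨hp, hu⟩⟩
    rw [Finset.mem_filter] at hp'
    exact ⟨p', hp'.1, hp'.2, fun p'' h1 h2 => hmin p'' (Finset.mem_filter.2 ⟨h1, h2⟩)⟩

end Terrain

/-! ### Building blocks: chains of vertices, pyramids, padding, the flat triangle -/

theorem card_triple_eq_three {x y z : Plane} (h : ({x, y, z} : Finset Plane).card = 3) :
    x ≠ y ∧ x ≠ z ∧ y ≠ z := by
  refine ⟨?_, ?_, ?_⟩ <;> rintro rfl
  · have := Finset.card_le_two (a := x) (b := z)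
    simp at h; omega
  · have := Finset.card_le_two (a := y) (b := x)
    rw [Finset.insert_comm, Finset.insert_eq_of_mem (Finset.mem_singleton_self x)] at h; omega
  · have := Finset.card_le_two (a := x) (b := y)
    simp at h; omega

theorem isBary_triple {x y z : Plane}
    (hD : (y.1 - x.1) * (z.2 - x.2) - (z.1 - x.1) * (y.2 - x.2) ≠ 0) :
    ∃ l, IsBary {x, y, z} l := by
  have hxy : x ≠ y := by rintro rfl; apply hD; ring
  have hxz : x ≠ z := by rintro rfl; apply hD; ring
  have hyz : y ≠ z := by rintro rfl; apply hD; ring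
  set D := (y.1 - x.1) * (z.2 - x.2) - (z.1 - x.1) * (y.2 - x.2) with hDdef
  have hsum : ∀ {M : Type} [AddCommMonoid M] (f : Plane → M),
      ∑ v ∈ ({x, y, z} : Finset Plane), f v = f x + (f y + f z) := by
    intro M _ f
    rw [Finset.sum_insert (by simp [hxy, hxz]), Finset.sum_pair hyz]
  refine ⟨fun v u => if v = x then
      ((y.1 - u.1) * (z.2 - u.2) - (z.1 - u.1) * (y.2 - u.2)) / D
    else if v = y then ((u.1 - x.1) * (z.2 - x.2) - (z.1 - x.1) * (u.2 - x.2)) / D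
    else ((y.1 - x.1) * (u.2 - x.2) - (u.1 - x.1) * (y.2 - x.2)) / D, ?_, ?_, ?_, ?_⟩
  · intro v
    by_cases h1 : v = x
    · refine ⟨(y.2 - z.2) / D, (z.1 - y.1) / D, (y.1 * z.2 - z.1 * y.2) / D, fun u => ?_⟩
      simp only [h1, if_true]; ring
    · by_cases h2 : v = y
      · refine ⟨(z.2 - x.2) / D, -(z.1 - x.1) / D,
          (-x.1 * (z.2 - x.2) + (z.1 - x.1) * x.2) / D, fun u => ?_⟩
        simp only [h2, hxy.symm, if_true, if_false]; ring
      · refine ⟨-(y.2 - x.2) / D, (y.1 - x.1) / D,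
          (x.1 * (y.2 - x.2) - (y.1 - x.1) * x.2) / D, fun u => ?_⟩
        simp only [h1, h2, if_false]; ring
  · intro u
    rw [hsum]
    simp only [hxy.symm, hxz.symm, hyz.symm, if_true, if_false]
    field_simp
    rw [hDdef]; ring
  · intro u
    rw [hsum]
    simp only [hxy.symm, hxz.symm, hyz.symm, if_true, if_false]
    ext
    · simp only [Prod.fst_add, Prod.smul_fst, smul_eq_mul]
      field_simp
      rw [hDdef]; ring
    · simp only [Prod.snd_add, Prod.smul_snd, smul_eq_mul]
      field_simp
      rw [hDdef]; ring
  · have e0 : ∀ a : ℝ, a = D → a / D = 1 := fun a h => by rw [h, div_self hD]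
    have e1 : ∀ a : ℝ, a = 0 → a / D = 0 := fun a h => by rw [h, zero_div]
    intro v hv w hw
    simp only [Finset.mem_insert, Finset.mem_singleton] at hv hw
    rcases hv with rfl | rfl | rfl <;> rcases hw with rfl | rfl | rfl <;>
      simp only [hxy, hxz, hyz, hxy.symm, hxz.symm, hyz.symm, if_true, if_false] <;>
      first
      | (apply e1; ring1)
      | (apply e0; ring1)

theorem subTriangle_triple {x y z : Plane} (hxy : x ≠ y) (hxz : x ≠ z) (hyz : y ≠ z) (p : Plane) :
    ({x, y, z} : Finset Plane).image (subTriangle {x, y, z} p) =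
      {{p, y, z}, {p, x, z}, {p, x, y}} := by
  have h1 : subTriangle {x, y, z} p x = {p, y, z} := by
    ext a; simp only [subTriangle, Finset.mem_insert, Finset.mem_erase, Finset.mem_singleton]
    constructor
    · tauto
    · rintro (rfl | rfl | rfl) <;> simp [hxy.symm, hxz.symm]
  have h2 : subTriangle {x, y, z} p y = {p, x, z} := by
    ext a; simp only [subTriangle, Finset.mem_insert, Finset.mem_erase, Finset.mem_singleton]
    constructor
    · tauto
    · rintro (rfl | rfl | rfl) <;> simp [hxy, hyz.symm]
  have h3 : subTriangle {x, y, z} p z = {p, x, y} := by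
    ext a; simp only [subTriangle, Finset.mem_insert, Finset.mem_erase, Finset.mem_singleton]
    constructor
    · tauto
    · rintro (rfl | rfl | rfl) <;> simp [hxz, hyz]
  rw [Finset.image_insert, Finset.image_insert, Finset.image_singleton, h1, h2, h3]

namespace Terrain

/-- Every triangle of `T'` lies in a triangle of `T`. -/
def Refines (T' T : Terrain) : Prop :=
  ∀ t ∈ T'.triangles, ∃ s ∈ T.triangles, convexHull ℝ (t : Set Plane) ⊆ convexHull ℝ (s : Set Plane)

theorem Refines.refl (T : Terrain) : T.Refines T := fun t ht => ⟨t, ht, subset_rfl⟩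

theorem Refines.trans {T₁ T₂ T₃ : Terrain} (h : T₁.Refines T₂) (h' : T₂.Refines T₃) :
    T₁.Refines T₃ := by
  intro t ht
  obtain ⟨s, hs, hts⟩ := h t ht
  obtain ⟨r, hr, hsr⟩ := h' s hs
  exact ⟨r, hr, hts.trans hsr⟩

theorem refines_of_split {T T' : Terrain} {t : Finset Plane} (ht : t ∈ T.triangles) {p : Plane}
    (hp : p ∈ openCell t)
    (h : T'.triangles = T.triangles.erase t ∪ t.image (subTriangle t p)) : T'.Refines T := by
  intro s hs
  rw [h, Finset.mem_union, Finset.mem_erase, Finset.mem_image] at hs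
  rcases hs with ⟨-, hs⟩ | ⟨v, hv, rfl⟩
  · exact ⟨s, hs, subset_rfl⟩
  · obtain ⟨l, hl⟩ := T.exists_bary ht
    exact ⟨t, ht, hl.convexHull_subTriangle_subset (T.triangle_card t ht) hv hp⟩

theorem exists_split_triple (T : Terrain) {x y z p : Plane} (ht : {x, y, z} ∈ T.triangles)
    (hp : p ∈ openCell {x, y, z}) :
    ∃ T' : Terrain, T'.vertices = insert p T.vertices ∧ T'.domain = T.domain ∧
      (∀ u, T'.height u = T.height u) ∧ T'.Refines T ∧
      (∀ t ∈ T.triangles, t ≠ {x, y, z} → t ∈ T'.triangles) ∧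
      {p, y, z} ∈ T'.triangles ∧ {p, x, z} ∈ T'.triangles ∧ {p, x, y} ∈ T'.triangles := by
  obtain ⟨T', φ, h1, h2, h3, h4, -, -⟩ := T.exists_split ht hp 0
  obtain ⟨hxy, hxz, hyz⟩ := card_triple_eq_three (T.triangle_card _ ht)
  refine ⟨T', h1, h3, by simpa using h4, refines_of_split ht hp h2, ?_⟩
  rw [subTriangle_triple hxy hxz hyz] at h2
  rw [h2]
  refine ⟨fun t ht hne => Finset.mem_union_left _ (Finset.mem_erase.2 ⟨hne, ht⟩), ?_, ?_, ?_⟩ <;>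
    exact Finset.mem_union_right _ (by simp)

/-- Successive insertion of vertices `c 1`, …, `c k`, each in the triangle spanned by the previous
one and `y`, `z`. -/
theorem exists_chain (T : Terrain) (c : ℕ → Plane) {y z : Plane} (h0 : {c 0, y, z} ∈ T.triangles)
    (k : ℕ) (hc : ∀ i < k, c (i + 1) ∈ openCell {c i, y, z}) :
    ∃ T' : Terrain, T'.vertices = T.vertices ∪ (Finset.range k).image (fun i => c (i + 1)) ∧
      T'.vertices.card = T.vertices.card + k ∧ T'.domain = T.domain ∧
      (∀ u, T'.height u = T.height u) ∧ T'.Refines T ∧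
      (∀ i < k, c (i + 1) ∉ T.vertices) ∧
      (∀ t ∈ T.triangles, t ≠ {c 0, y, z} → t ∈ T'.triangles) ∧
      {c k, y, z} ∈ T'.triangles ∧
      (∀ i < k, {c i, c (i + 1), y} ∈ T'.triangles) ∧
      (∀ i < k, {c i, c (i + 1), z} ∈ T'.triangles) := by
  obtain ⟨h0y, h0z, hyz⟩ := card_triple_eq_three (T.triangle_card _ h0)
  have hyT : y ∈ T.vertices := T.triangle_subset _ h0 (by simp)
  have hzT : z ∈ T.vertices := T.triangle_subset _ h0 (by simp)
  induction k with
  | zero =>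
    exact ⟨T, by simp, by simp, rfl, fun _ => rfl, Refines.refl T, by simp, fun t ht _ => ht, h0,
      by simp, by simp⟩
  | succ k ih =>
    obtain ⟨T₁, hv, hcard, hd, hh, hr, hn, ht, hk, hy, hz⟩ := ih fun i hi => hc i (by omega)
    have hp := hc k (by omega)
    obtain ⟨T₂, hv', hd', hh', hr', ht', h1, h2, h3⟩ := T₁.exists_split_triple hk hp
    have hnew := T₁.notMem_vertices_of_mem_openCell hk hp
    have hn' : ∀ i < k + 1, c (i + 1) ∉ T.vertices := by
      intro i hi
      rcases Nat.lt_succ_iff_lt_or_eq.1 hi with h | rfl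
      · exact hn i h
      · intro h
        exact hnew (by rw [hv]; exact Finset.mem_union_left _ h)
    -- Triangles made earlier must differ from the one being split, so that they survive; for this
    -- `y` and `z` must not occur in the chain.
    have hcy : ∀ i ≤ k + 1, y ≠ c i := by
      rintro (_ | i) hi h
      · exact h0y h.symm
      · exact hn' i (by omega) (h ▸ hyT)
    have hcz : ∀ i ≤ k + 1, z ≠ c i := by
      rintro (_ | i) hi h
      · exact h0z h.symm
      · exact hn' i (by omega) (h ▸ hzT)
    have hney : ∀ i < k, ({c i, c (i + 1), y} : Finset Plane) ≠ {c k, y, z} := by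
      intro i hi h
      have : z ∈ ({c i, c (i + 1), y} : Finset Plane) := by rw [h]; simp
      simp only [Finset.mem_insert, Finset.mem_singleton] at this
      rcases this with h | h | h
      · exact hcz i (by omega) h
      · exact hcz (i + 1) (by omega) h
      · exact hyz h.symm
    have hnez : ∀ i < k, ({c i, c (i + 1), z} : Finset Plane) ≠ {c k, y, z} := by
      intro i hi h
      have : y ∈ ({c i, c (i + 1), z} : Finset Plane) := by rw [h]; simp
      simp only [Finset.mem_insert, Finset.mem_singleton] at this
      rcases this with h | h | h
      · exact hcy i (by omega) h
      · exact hcy (i + 1) (by omega) h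
      · exact hyz h
    refine ⟨T₂, ?_, ?_, hd'.trans hd, fun u => (hh' u).trans (hh u), hr'.trans hr, hn', ?_, h1,
      ?_, ?_⟩
    · rw [hv', hv, Finset.range_add_one, Finset.image_insert, Finset.union_insert]
    · rw [hv', Finset.card_insert_of_notMem hnew, hcard]; ring
    · intro t htT hne
      refine ht' t (ht t htT hne) ?_
      rintro rfl
      cases k with
      | zero => exact hne rfl
      | succ k => exact hn' k (by omega) (T.triangle_subset _ htT (by simp))
    · intro i hi
      rcases Nat.lt_succ_iff_lt_or_eq.1 hi with h | rfl
      · exact ht' _ (hy i h) (hney i h)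
      · rw [Finset.insert_comm]; exact h3
    · intro i hi
      rcases Nat.lt_succ_iff_lt_or_eq.1 hi with h | rfl
      · exact ht' _ (hz i h) (hnez i h)
      · rw [Finset.insert_comm]; exact h2

theorem exists_mem_openCell (T : Terrain) {t : Finset Plane} (ht : t ∈ T.triangles) :
    ∃ p, p ∈ openCell t := by
  refine ⟨_, fun _ => 1 / 3, fun _ _ => by norm_num, ?_, rfl⟩
  rw [Finset.sum_const, T.triangle_card t ht]; norm_num

theorem exists_fill (T : Terrain) (k : ℕ) :
    ∃ T' : Terrain, T.vertices ⊆ T'.vertices ∧ T'.vertices.card = T.vertices.card + k ∧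
      T'.domain = T.domain ∧ (∀ u, T'.height u = T.height u) ∧ T'.Refines T := by
  induction k with
  | zero => exact ⟨T, subset_rfl, rfl, rfl, fun _ => rfl, Refines.refl T⟩
  | succ k ih =>
    obtain ⟨T₁, hv, hc, hd, hh, hr⟩ := ih
    obtain ⟨t, ht⟩ := T₁.triangles_nonempty
    obtain ⟨p, hp⟩ := T₁.exists_mem_openCell ht
    obtain ⟨T₂, φ, h1, h2, h3, h4, -, -⟩ := T₁.exists_split ht hp 0
    refine ⟨T₂, ?_, ?_, h3.trans hd, fun u => ?_, (refines_of_split ht hp h2).trans hr⟩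
    · rw [h1]; exact hv.trans (Finset.subset_insert _ _)
    · rw [h1, Finset.card_insert_of_notMem (T₁.notMem_vertices_of_mem_openCell ht hp), hc]; ring
    · rw [h4, hh]; ring

/-- Erection of a pyramid over the part `{x, y, d}` of the triangle `{x, y, z}`. -/
theorem exists_pyramid (T : Terrain) {x y z d : Plane} (ht : {x, y, z} ∈ T.triangles)
    (hd : d ∈ openCell {x, y, z}) :
    ∃ T' : Terrain, T.vertices ⊆ T'.vertices ∧ T'.vertices.card = T.vertices.card + 2 ∧
      T'.domain = T.domain ∧ T'.Refines T ∧
      (∀ t ∈ T.triangles, t ≠ {x, y, z} → t ∈ T'.triangles) ∧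
      (∀ u ∈ openCell {x, y, d}, T.height u < T'.height u) ∧
      ∀ u ∉ openCell {x, y, d}, T'.height u = T.height u := by
  obtain ⟨T₁, hv, hdm, hh, hr, ht₁, -, -, h3⟩ := T.exists_split_triple ht hd
  have hdn := T.notMem_vertices_of_mem_openCell ht hd
  have h3' : ({x, y, d} : Finset Plane) ∈ T₁.triangles := by
    have : ({d, x, y} : Finset Plane) = {x, y, d} := by
      ext a; simp only [Finset.mem_insert, Finset.mem_singleton]; tauto
    rwa [← this]
  obtain ⟨p, hp⟩ := T₁.exists_mem_openCell h3'
  -- Of the two new vertices, `d` stays on the surface and bounds the foot of the pyramid; only `p`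
  -- is raised. Thus the foot can be made thin at will.
  obtain ⟨T₂, φ, k1, k2, k3, k4, k5, k6⟩ := T₁.exists_split h3' hp 1
  refine ⟨T₂, ?_, ?_, k3.trans hdm, (refines_of_split h3' hp k2).trans hr, ?_, ?_, ?_⟩
  · rw [k1, hv]; exact (Finset.subset_insert _ _).trans (Finset.subset_insert _ _)
  · rw [k1, Finset.card_insert_of_notMem (T₁.notMem_vertices_of_mem_openCell h3' hp), hv,
      Finset.card_insert_of_notMem hdn]
  · intro t htT hne
    rw [k2]
    refine Finset.mem_union_left _ (Finset.mem_erase.2 ⟨?_, ht₁ t htT hne⟩)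
    rintro rfl
    exact hdn (T.triangle_subset _ htT (by simp))
  · intro u hu
    rw [k4, hh]; linarith [k5 u hu]
  · intro u hu
    rw [k4, hh, k6 u hu]; ring

theorem exists_pyramids (T : Terrain) (x y z d : ℕ → Plane) (k : ℕ)
    (ht : ∀ j < k, {x j, y j, z j} ∈ T.triangles)
    (hne : ∀ i < k, ∀ j < k, i ≠ j → ({x i, y i, z i} : Finset Plane) ≠ {x j, y j, z j})
    (hd : ∀ j < k, d j ∈ openCell {x j, y j, z j}) :
    ∃ T' : Terrain, T.vertices ⊆ T'.vertices ∧ T'.vertices.card = T.vertices.card + 2 * k ∧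
      T'.domain = T.domain ∧ T'.Refines T ∧
      (∀ j < k, ∀ u ∈ openCell {x j, y j, d j}, T.height u < T'.height u) ∧
      ∀ u, (∀ j < k, u ∉ openCell {x j, y j, d j}) → T'.height u = T.height u := by
  -- The induction also needs the triangles still to be used to survive, and heights never to
  -- decrease.
  suffices H : ∀ r ≤ k, ∃ T' : Terrain, T.vertices ⊆ T'.vertices ∧
      T'.vertices.card = T.vertices.card + 2 * r ∧
      T'.domain = T.domain ∧ T'.Refines T ∧
      (∀ j < k, r ≤ j → {x j, y j, z j} ∈ T'.triangles) ∧ (∀ u, T.height u ≤ T'.height u) ∧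
      (∀ j < r, ∀ u ∈ openCell {x j, y j, d j}, T.height u < T'.height u) ∧
      ∀ u, (∀ j < r, u ∉ openCell {x j, y j, d j}) → T'.height u = T.height u by
    obtain ⟨T', h1, h2, h3, h4, -, -, h5⟩ := H k le_rfl
    exact ⟨T', h1, h2, h3, h4, h5⟩
  intro r
  induction r with
  | zero =>
    intro _
    exact ⟨T, subset_rfl, rfl, rfl, Refines.refl T, fun j hj _ => ht j hj, fun _ => le_rfl,
      by simp, fun _ _ => rfl⟩
  | succ r ih =>
    intro hr
    obtain ⟨T₁, h1, h2, h3, h4, h5, h6, h7, h8⟩ := ih (by omega)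
    obtain ⟨T₂, k1, k2, k3, k4, k5, k6, k7⟩ :=
      T₁.exists_pyramid (h5 r (by omega) le_rfl) (hd r (by omega))
    have hle : ∀ u, T₁.height u ≤ T₂.height u := by
      intro u
      by_cases hu : u ∈ openCell {x r, y r, d r}
      · exact (k6 u hu).le
      · exact (k7 u hu).ge
    refine ⟨T₂, h1.trans k1, by rw [k2, h2]; ring, k3.trans h3, k4.trans h4, ?_,
      fun u => (h6 u).trans (hle u), ?_, ?_⟩
    · intro j hj hrj
      exact k5 _ (h5 j hj (by omega)) (hne j hj r (by omega) (by omega))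
    · intro j hj u hu
      rcases Nat.lt_succ_iff_lt_or_eq.1 hj with h | rfl
      · exact (h7 j h u hu).trans_le (hle u)
      · exact (h6 u).trans_lt (k6 u hu)
    · intro u hu
      rw [k7 u (hu r (by omega)), h8 u fun j hj => hu j (by omega)]

theorem exists_flat_triangle {x y z : Plane}
    (hD : (y.1 - x.1) * (z.2 - x.2) - (z.1 - x.1) * (y.2 - x.2) ≠ 0) :
    ∃ T : Terrain, T.vertices = {x, y, z} ∧ T.triangles = {{x, y, z}} ∧
      T.domain = convexHull ℝ ({x, y, z} : Finset Plane) ∧ ∀ u, T.height u = 0 := by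
  have hxy : x ≠ y := by rintro rfl; apply hD; ring
  have hxz : x ≠ z := by rintro rfl; apply hD; ring
  have hyz : y ≠ z := by rintro rfl; apply hD; ring
  obtain ⟨l, hl⟩ := isBary_triple hD
  refine ⟨{
    vertices := {x, y, z}
    triangles := {{x, y, z}}
    height := fun _ => 0
    triangles_nonempty := Finset.singleton_nonempty _
    triangle_subset := by
      intro t ht; rw [Finset.mem_singleton.1 ht]
    triangle_card := by
      intro t ht; rw [Finset.mem_singleton.1 ht]
      exact Finset.card_eq_three.2 ⟨x, y, z, hxy, hxz, hyz, rfl⟩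
    triangle_indep := by
      intro t ht
      obtain rfl := Finset.mem_singleton.1 ht
      exact hl.affineIndependent
    vertex_mem := fun v hv => ⟨_, Finset.mem_singleton_self _, hv⟩
    face_to_face := by
      intro s hs t ht
      rw [Finset.mem_singleton.1 hs, Finset.mem_singleton.1 ht, Set.inter_self, Set.inter_self]
    convex_domain := by
      simp only [Finset.mem_singleton, Set.iUnion_iUnion_eq_left]
      exact convex_convexHull ℝ _
    height_affine := fun _ _ => ⟨0, 0, 0, by simp⟩ }, rfl, rfl, ?_, fun _ => rfl⟩
  simp only [domain, Finset.mem_singleton, Set.iUnion_iUnion_eq_left]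

/-! ### Visibility between points of height zero -/

theorem sees_of_height_eq_zero (T : Terrain) {p q : Plane} (hp : p ∈ T.domain) (hq : q ∈ T.domain)
    (h : ∀ w ∈ segment ℝ p q, T.height w = 0) : T.Sees p q := by
  refine ⟨hp, hq, ?_⟩
  rintro w ⟨a, b, ha, hb, hab, rfl⟩ ⟨-, hlt⟩
  have h1 := h _ ⟨a, b, ha, hb, hab, rfl⟩
  simp only [lift, Prod.smul_mk, Prod.mk_add_mk] at hlt
  rw [h p (left_mem_segment ℝ p q), h q (right_mem_segment ℝ p q)] at hlt
  rw [show (a • p + b • q : Plane) = a • p + b • q from rfl] at hlt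
  simp [h1] at hlt

/-- A sight line between points of height 0 has height 0 throughout, so it is blocked wherever it
passes over ground of positive height. With the ratio `s` fixed, it still passes over the open set
`O` when `q` moves a little. -/
theorem eventually_not_sees (T : Terrain) {p q : Plane} (hp : T.height p = 0)
    (hq : ∀ᶠ u in 𝓝 q, T.height u = 0) {O : Set Plane} (hO : IsOpen O) (hOd : O ⊆ T.domain)
    (hOh : ∀ u ∈ O, 0 < T.height u) {s : ℝ} (hs0 : 0 ≤ s) (hs1 : s ≤ 1)
    (hs : (1 - s) • p + s • q ∈ O) : ∀ᶠ u in 𝓝 q, ¬ T.Sees p u := by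
  have hc : Continuous fun u : Plane => (1 - s) • p + s • u := by fun_prop
  filter_upwards [hq, (hO.preimage hc).mem_nhds hs] with u hu huO
  rintro ⟨-, -, h⟩
  refine h ((1 - s) • T.lift p + s • T.lift u) ⟨1 - s, s, by linarith, hs0, by ring, rfl⟩ ?_
  refine ⟨hOd huO, ?_⟩
  have := hOh _ huO
  simpa [lift, hp, hu] using this

end Terrain

/-! ### Parameters and properties of the comb -/

/-- The horizontal distance of the viewpoints from the comb's first gap. -/
noncomputable def combShift (m N : ℕ) : ℝ := m * N + 1

/-- Half the width of the gaps of the comb. -/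
noncomputable def combGap (m N : ℕ) : ℝ := 1 / (32 * combShift m N)

/-- The size of the domain. -/
noncomputable def combSize (m N : ℕ) : ℝ := 8 * (combShift m N + m)

/-- The abscissas of the vertices along the comb: the teeth stand on the intervals from an even
index to the next odd one, and the other intervals are the gaps. -/
noncomputable def combAbscissa (m N i : ℕ) : ℝ :=
  if i = 0 then -combSize m N
  else if i % 2 = 1 then m * (i / 2 : ℕ) - combGap m N
  else m * (i / 2 : ℕ) - m + combGap m N

section Params

variable {m N : ℕ}

theorem one_le_combShift : 1 ≤ combShift m N := by
  unfold combShift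
  have : (0 : ℝ) ≤ (m : ℝ) * N := by positivity
  linarith

theorem combGap_pos : 0 < combGap m N := by
  have := one_le_combShift (m := m) (N := N)
  unfold combGap; positivity

theorem combGap_mul : combGap m N * combShift m N = 1 / 32 := by
  have := one_le_combShift (m := m) (N := N)
  unfold combGap; field_simp

theorem combGap_le : combGap m N ≤ 1 / 32 := by
  have h1 := one_le_combShift (m := m) (N := N)
  have h2 := combGap_mul (m := m) (N := N)
  have h3 := combGap_pos (m := m) (N := N)
  nlinarith

theorem combSize_ge : 8 * combShift m N + 8 * m ≤ combSize m N := by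
  unfold combSize; linarith

theorem combAbscissa_odd (j : ℕ) : combAbscissa m N (2 * j + 1) = m * j - combGap m N := by
  unfold combAbscissa
  rw [if_neg (by omega), if_pos (by omega), show (2 * j + 1) / 2 = j by omega]

theorem combAbscissa_even (j : ℕ) : combAbscissa m N (2 * j + 2) = m * j + combGap m N := by
  unfold combAbscissa
  rw [if_neg (by omega), if_neg (by omega), show (2 * j + 2) / 2 = j + 1 by omega]
  push_cast; ring

theorem combAbscissa_zero : combAbscissa m N 0 = -combSize m N := by
  simp [combAbscissa]

theorem combAbscissa_lt_succ (hm : 1 ≤ m) (i : ℕ) :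
    combAbscissa m N i < combAbscissa m N (i + 1) := by
  have hm' : (1 : ℝ) ≤ m := by exact_mod_cast hm
  have h1 := combGap_le (m := m) (N := N)
  have h2 := combGap_pos (m := m) (N := N)
  have h3 := combSize_ge (m := m) (N := N)
  have h4 := one_le_combShift (m := m) (N := N)
  rcases Nat.even_or_odd' i with ⟨j, rfl | rfl⟩
  · rcases j with _ | j
    · rw [combAbscissa_odd, mul_zero, combAbscissa_zero]
      push_cast; linarith
    · rw [show 2 * (j + 1) = 2 * j + 2 by ring, combAbscissa_even,
        show 2 * j + 2 + 1 = 2 * (j + 1) + 1 by ring, combAbscissa_odd]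
      push_cast; linarith
  · rw [combAbscissa_odd, show 2 * j + 1 + 1 = 2 * j + 2 by ring, combAbscissa_even]
    linarith

theorem combAbscissa_strictMono (hm : 1 ≤ m) : StrictMono (combAbscissa m N) :=
  strictMono_nat_of_lt_succ (combAbscissa_lt_succ hm)

theorem combAbscissa_lt (hm : 1 ≤ m) {i : ℕ} (hi : i ≤ 2 * N + 1) :
    combAbscissa m N i < combShift m N := by
  refine ((combAbscissa_strictMono hm).monotone hi).trans_lt ?_
  rw [combAbscissa_odd]
  have h2 := combGap_pos (m := m) (N := N)
  unfold combShift; linarith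

end Params

/-- The vertices along the comb. -/
noncomputable def combPoint (m N i : ℕ) : Plane := (combAbscissa m N i, 0)

/-- The upper right corner of the domain. -/
noncomputable def cornerTop (m N : ℕ) : Plane := (combSize m N, combSize m N)

/-- A flat terrain, apart from a comb of `N + 1` teeth `O 0`, …, `O N`, with viewpoints on both sides
in front of the comb. -/
structure IsComb (m N kA kB : ℕ) (T : Terrain) (O : ℕ → Set Plane) : Prop where
  mem_left : ∀ i < kA, ((-(combShift m N + i), -1) : Plane) ∈ T.vertices
  mem_right : ∀ i < kB, ((combShift m N + i, -1) : Plane) ∈ T.vertices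
  mem_interior : ∀ x y : ℝ, |x| < combSize m N / 2 → |y| < combSize m N / 4 →
    ((x, y) : Plane) ∈ interior T.domain
  isOpen : ∀ j ≤ N, IsOpen (O j)
  subset_domain : ∀ j ≤ N, O j ⊆ T.domain
  height_pos : ∀ j ≤ N, ∀ u ∈ O j, 0 < T.height u
  height_eq_zero : ∀ u, (∀ j ≤ N, u ∉ O j) → T.height u = 0
  bounds : ∀ j ≤ N, ∀ u ∈ O j, combAbscissa m N (2 * j) ≤ u.1 ∧
    u.1 ≤ combAbscissa m N (2 * j + 1) ∧ -(combGap m N / combSize m N) ≤ u.2 ∧ u.2 ≤ 0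
  blocks : ∀ j ≤ N, ∀ x : ℝ, combAbscissa m N (2 * j) < x → x < combAbscissa m N (2 * j + 1) →
    ∀ ξ : ℝ, ∀ᶠ ε in 𝓝[>] (0 : ℝ), ((x + ε * ξ, -ε) : Plane) ∈ O j
  slivers : ∀ i < 2 * N + 1, ∀ i' < 2 * N + 1, i ≠ i' →
    ∀ u ∈ openCell {combPoint m N i, combPoint m N (i + 1), cornerTop m N},
    ∀ u' ∈ openCell {combPoint m N i', combPoint m N (i' + 1), cornerTop m N},
    ∀ t ∈ T.triangles, u ∈ convexHull ℝ (t : Set Plane) → u' ∉ convexHull ℝ (t : Set Plane)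

/-! ### Explicit barycentric weights for the inserted vertices; shape of the teeth -/

theorem mem_openCell_right {X x x' : ℝ} (hX : 0 < X) (h1 : x < x') (h2 : x' < X) :
    ((x', 0) : Plane) ∈ openCell {((x, 0) : Plane), (X, X), (X, -X)} := by
  have h3 : 0 < X - x := by linarith
  refine mem_openCell_triple (a := (X - x') / (X - x)) (b := (x' - x) / (2 * (X - x)))
    (c := (x' - x) / (2 * (X - x))) ?_ ?_ ?_ ?_ ?_ ?_ ?_ ?_ ?_
  · intro h; have := congrArg Prod.fst h; dsimp only at this; linarith
  · intro h; have := congrArg Prod.fst h; dsimp only at this; linarith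
  · intro h; have := congrArg Prod.snd h; dsimp only at this; linarith
  · exact div_pos (by linarith) h3
  · exact div_pos (by linarith) (by linarith)
  · exact div_pos (by linarith) (by linarith)
  · field_simp; ring
  · dsimp only; field_simp; ring
  · dsimp only; ring

theorem mem_openCell_domain {X x y : ℝ} (hX : 0 < X) (hx : |x| < X / 2) (hy : |y| < X / 4) :
    ((x, y) : Plane) ∈ openCell {((-X, 0) : Plane), (X, X), (X, -X)} := by
  rw [abs_lt] at hx hy
  refine mem_openCell_triple (a := (X - x) / (2 * X)) (b := (X + x + 2 * y) / (4 * X))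
    (c := (X + x - 2 * y) / (4 * X)) ?_ ?_ ?_ ?_ ?_ ?_ ?_ ?_ ?_
  · intro h; have := congrArg Prod.fst h; dsimp only at this; linarith
  · intro h; have := congrArg Prod.fst h; dsimp only at this; linarith
  · intro h; have := congrArg Prod.snd h; dsimp only at this; linarith
  · exact div_pos (by linarith) (by linarith)
  · exact div_pos (by linarith) (by linarith)
  · exact div_pos (by linarith) (by linarith)
  · field_simp; ring
  · dsimp only; field_simp; ring
  · dsimp only; field_simp; ring

theorem mem_openCell_left_first {X S w : ℝ} (hw0 : 0 < w) (hw : w < 1) (hS : 1 ≤ S)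
    (hX : S + 4 < X) :
    ((-S, -1) : Plane) ∈ openCell {((-w, 0) : Plane), (-X, 0), (X, -X)} := by
  have hX0 : 0 < X := by linarith
  have h3 : 0 < X - w := by linarith
  have hb : 0 < S + 1 - w * (1 - 1 / X) := by
    have : 0 < 1 / X := by positivity
    nlinarith
  refine mem_openCell_triple (a := 1 - 1 / X - (S + 1 - w * (1 - 1 / X)) / (X - w))
    (b := (S + 1 - w * (1 - 1 / X)) / (X - w)) (c := 1 / X) ?_ ?_ ?_ ?_ ?_ ?_ ?_ ?_ ?_
  · intro h; have := congrArg Prod.fst h; dsimp only at this; linarith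
  · intro h; have := congrArg Prod.fst h; dsimp only at this; linarith
  · intro h; have := congrArg Prod.fst h; dsimp only at this; linarith
  · have h4 : (S + 1 - w * (1 - 1 / X)) / (X - w) < 1 - 1 / X := by
      rw [div_lt_iff₀ h3]
      have h5 : (1 / X) * X = 1 := by field_simp
      nlinarith
    linarith
  · exact div_pos hb h3
  · positivity
  · ring
  · dsimp only; field_simp; ring
  · dsimp only; field_simp; ring

theorem mem_openCell_left_next {X s : ℝ} (hs : 1 ≤ s) (hX : s + 4 < X) :
    ((-(s + 1), -1) : Plane) ∈ openCell {((-s, -1) : Plane), (-X, 0), (X, -X)} := by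
  have hX0 : 0 < X := by linarith
  have hD : 0 < X - 2 - s := by linarith
  refine mem_openCell_triple (a := 1 - 1 / (X - 2 - s)) (b := (X - 1) / (X * (X - 2 - s)))
    (c := 1 / (X * (X - 2 - s))) ?_ ?_ ?_ ?_ ?_ ?_ ?_ ?_ ?_
  · intro h; have := congrArg Prod.fst h; dsimp only at this; linarith
  · intro h; have := congrArg Prod.fst h; dsimp only at this; linarith
  · intro h; have := congrArg Prod.fst h; dsimp only at this; linarith
  · have : 1 / (X - 2 - s) < 1 := by rw [div_lt_one hD]; linarith
    linarith
  · exact div_pos (by linarith) (by positivity)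
  · positivity
  · field_simp; ring
  · dsimp only; field_simp; ring
  · dsimp only; field_simp; ring

theorem mem_openCell_right_first {X S x : ℝ} (hx : x + 1 ≤ S) (hx0 : 0 < x) (hX : S + 4 < X) :
    ((S, -1) : Plane) ∈ openCell {((x, 0) : Plane), (X, X), (X, -X)} := by
  have hX0 : 0 < X := by linarith
  have hD : 0 < X - x := by linarith
  have hlt : 1 / X < (S - x) / (X - x) := by
    rw [div_lt_div_iff₀ hX0 hD]; nlinarith
  have hpos : 0 < 1 / X := by positivity
  refine mem_openCell_triple (a := (X - S) / (X - x)) (b := ((S - x) / (X - x) - 1 / X) / 2)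
    (c := ((S - x) / (X - x) + 1 / X) / 2) ?_ ?_ ?_ ?_ ?_ ?_ ?_ ?_ ?_
  · intro h; have := congrArg Prod.fst h; dsimp only at this; linarith
  · intro h; have := congrArg Prod.fst h; dsimp only at this; linarith
  · intro h; have := congrArg Prod.snd h; dsimp only at this; linarith
  · exact div_pos (by linarith) hD
  · linarith
  · linarith
  · field_simp; ring
  · dsimp only; field_simp; ring
  · dsimp only; field_simp; ring

theorem mem_openCell_right_next {X s : ℝ} (hs : 1 ≤ s) (hX : s + 4 < X) :
    ((s + 1, -1) : Plane) ∈ openCell {((s, -1) : Plane), (X, X), (X, -X)} := by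
  have hX0 : 0 < X := by linarith
  have hD : 0 < X - s := by linarith
  refine mem_openCell_triple (a := 1 - 1 / (X - s)) (b := (X - 1) / (2 * X * (X - s)))
    (c := (X + 1) / (2 * X * (X - s))) ?_ ?_ ?_ ?_ ?_ ?_ ?_ ?_ ?_
  · intro h; have := congrArg Prod.fst h; dsimp only at this; linarith
  · intro h; have := congrArg Prod.fst h; dsimp only at this; linarith
  · intro h; have := congrArg Prod.snd h; dsimp only at this; linarith
  · have : 1 / (X - s) < 1 := by rw [div_lt_one hD]; linarith
    linarith
  · exact div_pos (by linarith) (by positivity)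
  · positivity
  · field_simp; ring
  · dsimp only; field_simp; ring
  · dsimp only; field_simp; ring

theorem openCell_triple_isOpen {x y z : Plane}
    (hD : (y.1 - x.1) * (z.2 - x.2) - (z.1 - x.1) * (y.2 - x.2) ≠ 0) :
    IsOpen (openCell {x, y, z}) := by
  obtain ⟨l, hl⟩ := isBary_triple hD
  exact hl.isOpen_openCell

theorem tooth_isOpen {a b p e : ℝ} (hab : a < b) (he : 0 < e) :
    IsOpen (openCell {((a, 0) : Plane), (b, 0), (p, -e)}) := by
  refine openCell_triple_isOpen ?_
  dsimp only
  have : 0 < (b - a) * e := mul_pos (by linarith) he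
  intro h
  linarith

theorem tooth_bounds {a b p e : ℝ} (he : 0 < e) (hap : a ≤ p) (hpb : p ≤ b) (hab : a ≤ b)
    {u : Plane} (hu : u ∈ openCell {((a, 0) : Plane), (b, 0), (p, -e)}) :
    a ≤ u.1 ∧ u.1 ≤ b ∧ -e ≤ u.2 ∧ u.2 ≤ 0 := by
  have h1 : convexHull ℝ (({((a, 0) : Plane), (b, 0), (p, -e)} : Finset Plane) : Set Plane) ⊆
      Set.Icc a b ×ˢ Set.Icc (-e) 0 := by
    refine convexHull_min ?_ ((convex_Icc _ _).prod (convex_Icc _ _))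
    intro v hv
    simp only [Finset.coe_insert, Finset.coe_singleton, Set.mem_insert_iff,
      Set.mem_singleton_iff] at hv
    rcases hv with rfl | rfl | rfl
    · exact ⟨⟨le_rfl, hab⟩, by simpa using he.le, le_rfl⟩
    · exact ⟨⟨hab, le_rfl⟩, by simpa using he.le, le_rfl⟩
    · exact ⟨⟨hap, hpb⟩, le_rfl, by simpa using he.le⟩
  obtain ⟨⟨h2, h3⟩, h4, h5⟩ := h1 (openCell_subset_convexHull _ hu)
  exact ⟨h2, h3, h4, h5⟩

/-- As `ε` tends to 0, the weights at the two base corners tend to positive limits, since `x` is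
interior to the base, while the weight `ε / e` of the tip is positive. -/
theorem tooth_blocks {a b p e x : ℝ} (he : 0 < e) (hax : a < x) (hxb : x < b) (ξ : ℝ) :
    ∀ᶠ ε in 𝓝[>] (0 : ℝ), ((x + ε * ξ, -ε) : Plane) ∈
      openCell {((a, 0) : Plane), (b, 0), (p, -e)} := by
  have hab : 0 < b - a := by linarith
  have h1 : ∀ᶠ ε in 𝓝[>] (0 : ℝ), 0 < (1 - ε / e) * b - (x + ε * ξ - ε / e * p) := by
    have hc : Continuous fun ε : ℝ => (1 - ε / e) * b - (x + ε * ξ - ε / e * p) := by fun_prop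
    refine Filter.Eventually.filter_mono nhdsWithin_le_nhds
      (hc.continuousAt.eventually (lt_mem_nhds ?_))
    simp; linarith
  have h2 : ∀ᶠ ε in 𝓝[>] (0 : ℝ), 0 < (x + ε * ξ - ε / e * p) - (1 - ε / e) * a := by
    have hc : Continuous fun ε : ℝ => (x + ε * ξ - ε / e * p) - (1 - ε / e) * a := by fun_prop
    refine Filter.Eventually.filter_mono nhdsWithin_le_nhds
      (hc.continuousAt.eventually (lt_mem_nhds ?_))
    simp; linarith
  filter_upwards [h1, h2, self_mem_nhdsWithin] with ε h1 h2 hε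
  have hε' : 0 < ε := hε
  refine mem_openCell_triple (a := ((1 - ε / e) * b - (x + ε * ξ - ε / e * p)) / (b - a))
    (b := ((x + ε * ξ - ε / e * p) - (1 - ε / e) * a) / (b - a))
    (c := ε / e) ?_ ?_ ?_ (div_pos h1 hab) (div_pos h2 hab) (div_pos hε' he) ?_ ?_ ?_
  · intro h; have := congrArg Prod.fst h; dsimp only at this; linarith
  · intro h; have := congrArg Prod.snd h; dsimp only at this; linarith
  · intro h; have := congrArg Prod.snd h; dsimp only at this; linarith
  · field_simp; ring
  · dsimp only; field_simp; ring
  · dsimp only; field_simp; ring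

/-- The tip of a tooth on the interval from `a` to `b`, near the base and in the direction of `z`. -/
noncomputable def toothTip (a b η : ℝ) (z : Plane) : Plane :=
  ((1 - η) * ((a + b) / 2) + η * z.1, -(η * -z.2))

theorem toothTip_mem_openCell {a b η : ℝ} {z : Plane} (hab : a < b) (hη : 0 < η) (hη1 : η < 1)
    (hz : z.2 < 0) : toothTip a b η z ∈ openCell {((a, 0) : Plane), (b, 0), z} := by
  refine mem_openCell_triple (a := (1 - η) / 2) (b := (1 - η) / 2) (c := η) ?_ ?_ ?_
    (by linarith) (by linarith) hη (by ring) ?_ ?_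
  · intro h; have := congrArg Prod.fst h; dsimp only at this; linarith
  · rintro rfl; dsimp only at hz; linarith
  · rintro rfl; dsimp only at hz; linarith
  · simp only [toothTip]; ring
  · simp only [toothTip]; ring

namespace Terrain

theorem mem_domain_of_mem_vertices (T : Terrain) {v : Plane} (hv : v ∈ T.vertices) :
    v ∈ T.domain := by
  obtain ⟨t, ht, hvt⟩ := T.vertex_mem v hv
  exact Set.mem_biUnion (x := t) ht (subset_convexHull ℝ _ hvt)

theorem openCell_subset_domain (T : Terrain) {t : Finset Plane} (ht : ∀ v ∈ t, v ∈ T.domain) :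
    openCell t ⊆ T.domain :=
  (openCell_subset_convexHull t).trans (convexHull_min ht T.convex_domain)

end Terrain

/-! ### Construction of the comb terrain -/

/-- The sequence that starts with `p` and goes on with `g`. -/
def consPoint (p : Plane) (g : ℕ → Plane) : ℕ → Plane
  | 0 => p
  | i + 1 => g i

-- The vertices are 3 corners, `2 * N + 1` along the base, `kA + kB` viewpoints, 2 for each of the
-- `N + 1` teeth, and `f` for padding. The base chain fans out to both right-hand corners: the
-- triangles above it are the slivers, those below it carry the teeth.
open Terrain in
theorem exists_isComb {m N kA kB : ℕ} (hm : 1 ≤ m) (hN : 1 ≤ N) (hA : 1 ≤ kA) (hAm : kA ≤ m)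
    (hBm : kB ≤ m) (f : ℕ) : ∃ (T : Terrain) (O : ℕ → Set Plane),
      T.vertices.card = 4 * N + 6 + kA + kB + f ∧ IsComb m N kA kB T O := by
  have hm' : (1 : ℝ) ≤ m := by exact_mod_cast hm
  have hN' : (1 : ℝ) ≤ N := by exact_mod_cast hN
  have hmN : (1 : ℝ) ≤ m * N := by nlinarith
  have hw0 := combGap_pos (m := m) (N := N)
  have hw1 := combGap_le (m := m) (N := N)
  have hS1 := one_le_combShift (m := m) (N := N)
  have hX := combSize_ge (m := m) (N := N)
  have hlt := combAbscissa_lt_succ (N := N) hm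
  have hmono := combAbscissa_strictMono (N := N) hm
  have hx1 : combAbscissa m N 1 = -combGap m N := by
    have := combAbscissa_odd (m := m) (N := N) 0
    simpa using this
  set w := combGap m N with hw
  set S := combShift m N with hS
  set X := combSize m N with hXdef
  set c := combPoint m N with hc
  have hX0 : 0 < X := by linarith
  have hc0 : c 0 = (-X, 0) := by rw [hc, combPoint, combAbscissa_zero]
  have hcinj : Function.Injective c := fun i j h => hmono.injective (congrArg Prod.fst h)
  have hcsnd : ∀ i, (c i).2 = 0 := fun _ => rfl
  obtain ⟨T₀, hv₀, ht₀, hd₀, hh₀⟩ := exists_flat_triangle (x := ((-X, 0) : Plane)) (y := (X, X))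
    (z := (X, -X)) (by dsimp only; nlinarith)
  have hc₀ : T₀.vertices.card = 3 := by
    rw [hv₀]
    exact T₀.triangle_card _ (by rw [ht₀]; exact Finset.mem_singleton_self _)
  -- the comb's base
  obtain ⟨T₁, hv₁, hc₁, hd₁, hh₁, hr₁, -, -, hl₁, hQ₁, hR₁⟩ :=
    T₀.exists_chain c (y := (X, X)) (z := (X, -X)) (by rw [ht₀, hc0]; exact Finset.mem_singleton_self _)
      (2 * N + 1) (fun i hi => mem_openCell_right hX0 (hlt i) (by
        have := combAbscissa_lt (m := m) (N := N) hm (i := i + 1) (by omega)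
        rw [← hS] at this; linarith))
  -- the viewpoints
  have hcast : ∀ {k : ℕ}, k ≤ m → ∀ i < k, (i : ℝ) + 1 ≤ m := fun hk i hi => by
    exact_mod_cast (by omega : i + 1 ≤ m)
  obtain ⟨T₂, hv₂, hc₂, hd₂, hh₂, hr₂, -, ht₂, -, hP₂, -⟩ :=
    T₁.exists_chain (consPoint (c 1) fun i => (-(S + i), -1)) (y := (-X, 0)) (z := (X, -X)) (by
      have := hR₁ 0 (by omega)
      rwa [hc0, Finset.insert_comm] at this) kA (by
    rintro (_ | i) hi
    · change ((-(S + (0 : ℕ)), -1) : Plane) ∈ openCell {(combAbscissa m N 1, 0), (-X, 0), (X, -X)}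
      rw [hx1, Nat.cast_zero, add_zero]
      exact mem_openCell_left_first hw0 (by linarith) hS1 (by linarith)
    · change ((-(S + (i + 1 : ℕ)), -1) : Plane) ∈ openCell {(-(S + i), -1), (-X, 0), (X, -X)}
      have hi' := hcast hAm (i + 1) hi
      push_cast at hi' ⊢
      rw [← add_assoc]
      have : (0 : ℝ) ≤ i := by positivity
      exact mem_openCell_left_next (by linarith) (by linarith))
  have hlast : combAbscissa m N (2 * N + 1) = m * N - w := combAbscissa_odd N
  have hQc : ∀ i, ((X, X) : Plane) ≠ c i := fun i h => hX0.ne' (congrArg Prod.snd h)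
  have hRc : ∀ i, ((X, -X) : Plane) ≠ c i := fun i h =>
    hX0.ne' (neg_eq_zero.1 (congrArg Prod.snd h))
  have hQR : ((X, X) : Plane) ≠ (X, -X) := fun h => by
    have := congrArg Prod.snd h; dsimp only at this; linarith
  obtain ⟨T₃, hv₃, hc₃, hd₃, hh₃, hr₃, -, ht₃, -, -, -⟩ :=
    T₂.exists_chain (consPoint (c (2 * N + 1)) fun i => (S + i, -1)) (y := (X, X)) (z := (X, -X)) (by
      refine ht₂ _ hl₁ fun h => ?_
      replace h : ({c (2 * N + 1), (X, X), (X, -X)} : Finset Plane) = {c 1, (-X, 0), (X, -X)} := h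
      have h1 : ((-X, 0) : Plane) ∈ ({c (2 * N + 1), (X, X), (X, -X)} : Finset Plane) := by
        rw [h]; simp
      rw [← hc0] at h1
      simp only [Finset.mem_insert, Finset.mem_singleton] at h1
      rcases h1 with h1 | h1 | h1
      · have := hcinj h1; omega
      · exact hQc _ h1.symm
      · exact hRc _ h1.symm) kB (by
    rintro (_ | i) hi
    · change ((S + (0 : ℕ), -1) : Plane) ∈
        openCell {(combAbscissa m N (2 * N + 1), 0), (X, X), (X, -X)}
      rw [hlast, Nat.cast_zero, add_zero]
      refine mem_openCell_right_first ?_ (by linarith) (by linarith)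
      rw [hS, combShift]; linarith
    · change ((S + (i + 1 : ℕ), -1) : Plane) ∈ openCell {(S + i, -1), (X, X), (X, -X)}
      have hi' := hcast hBm (i + 1) hi
      push_cast at hi' ⊢
      rw [← add_assoc]
      have : (0 : ℝ) ≤ i := by positivity
      exact mem_openCell_right_next (by linarith) (by linarith))
  -- the teeth
  set η := w / X ^ 2 with hη
  have hη0 : 0 < η := by positivity
  have hηX : η * X = w / X := by rw [hη]; field_simp
  have hwX : w / X ≤ 1 / 256 := by
    rw [div_le_iff₀ hX0]; linarith
  have hη1 : η < 1 := by
    have : η * 1 ≤ η * X := mul_le_mul_of_nonneg_left (by linarith) hη0.le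
    linarith
  -- Third corner of the triangle below the base of tooth `j`. Below tooth 0 the insertion of the
  -- left viewpoints has changed it to the first of them; hence the need for `1 ≤ kA`.
  set z : ℕ → Plane := fun j => if j = 0 then (-S, -1) else (X, -X) with hz
  have hz0 : z 0 = (-S, -1) := by simp [hz]
  have hzs : ∀ j, j ≠ 0 → z j = (X, -X) := fun j hj => by simp [hz, hj]
  have hz2 : ∀ j, (z j).2 < 0 := by
    intro j
    by_cases hj : j = 0
    · rw [hj, hz0]; norm_num
    · rw [hzs j hj]; dsimp only; linarith
  have hzc : ∀ j i, c i ≠ z j := fun j i h => by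
    have := hz2 j
    rw [← h, hcsnd] at this; exact lt_irrefl _ this
  set d : ℕ → Plane := fun j =>
    toothTip (combAbscissa m N (2 * j)) (combAbscissa m N (2 * j + 1)) η (z j) with hd
  have hdj : ∀ j ≤ N, ∃ p e, d j = (p, -e) ∧ 0 < e ∧ e ≤ w / X ∧ combAbscissa m N (2 * j) ≤ p ∧
      p ≤ combAbscissa m N (2 * j + 1) := by
    intro j hjN
    refine ⟨_, _, rfl, mul_pos hη0 (by linarith [hz2 j]), ?_, ?_⟩
    · rw [← hηX]
      refine mul_le_mul_of_nonneg_left ?_ hη0.le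
      by_cases hj : j = 0
      · rw [hj, hz0]; dsimp only; linarith
      · rw [hzs j hj]; dsimp only; linarith
    · have hab := hlt (2 * j)
      set a := combAbscissa m N (2 * j) with ha
      set b := combAbscissa m N (2 * j + 1) with hb
      by_cases hj : j = 0
      · subst hj
        have ha' : a = -X := combAbscissa_zero
        have hb' : b = -w := hx1
        rw [hz0]
        dsimp only
        constructor <;> nlinarith
      · obtain ⟨i, rfl⟩ := Nat.exists_eq_succ_of_ne_zero hj
        have ha' : a = m * i + w := by rw [ha, ← combAbscissa_even]; rfl
        have hb' : b = m * (i + 1 : ℕ) - w := by rw [hb, combAbscissa_odd]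
        push_cast at hb'
        have haX : -X < a := by
          rw [← combAbscissa_zero (m := m) (N := N)]; exact hmono (by simp)
        rw [hzs _ hj]
        have hbX : b < X := (combAbscissa_lt hm (by omega)).trans (by linarith)
        have h1 : 0 ≤ (m : ℝ) * i := by positivity
        have h2 : η * (X - (a + b) / 2) ≤ η * X := mul_le_mul_of_nonneg_left (by linarith) hη0.le
        have h3 : 0 ≤ η * (X - (a + b) / 2) := mul_nonneg hη0.le (by linarith)
        rw [mul_add, mul_one] at hb'
        constructor <;> dsimp only <;> linarith
  obtain ⟨T₄, hv₄, hc₄, hd₄, hr₄, hpos, hzero⟩ :=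
    T₃.exists_pyramids (fun j => c (2 * j)) (fun j => c (2 * j + 1)) z d (N + 1) (by
      intro j hj
      by_cases hj0 : j = 0
      · subst hj0
        have h1 : ({c 0, c 1, z 0} : Finset Plane) = {c 1, (-(S + (0 : ℕ)), -1), (-X, 0)} := by
          rw [hz0, hc0, Nat.cast_zero, add_zero]
          ext v; simp only [Finset.mem_insert, Finset.mem_singleton]; tauto
        change {c 0, c 1, z 0} ∈ T₃.triangles
        rw [h1]
        refine ht₃ _ (hP₂ 0 (by omega)) fun h => ?_
        have h2 : ((X, X) : Plane) ∈
            ({c 1, (-(S + (0 : ℕ)), -1), (-X, 0)} : Finset Plane) := by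
          exact h ▸ (by simp)
        rw [← hc0] at h2
        simp only [Finset.mem_insert, Finset.mem_singleton] at h2
        rcases h2 with h2 | h2 | h2
        · exact hQc _ h2
        · have := congrArg Prod.snd h2; dsimp only at this; linarith
        · exact hQc _ h2
      · rw [hzs j hj0]
        refine ht₃ _ (ht₂ _ (hR₁ (2 * j) (by omega)) fun h => ?_) fun h => ?_
        · have h2 : c 1 ∈ ({c (2 * j), c (2 * j + 1), (X, -X)} : Finset Plane) := by
            rw [h]; exact Finset.mem_insert_self _ _
          simp only [Finset.mem_insert, Finset.mem_singleton] at h2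
          rcases h2 with h2 | h2 | h2
          · have := hcinj h2; omega
          · have := hcinj h2; omega
          · exact hRc _ h2.symm
        · have h2 : ((X, X) : Plane) ∈ ({c (2 * j), c (2 * j + 1), (X, -X)} : Finset Plane) := by
            rw [h]; simp
          simp only [Finset.mem_insert, Finset.mem_singleton] at h2
          rcases h2 with h2 | h2 | h2
          · exact hQc _ h2
          · exact hQc _ h2
          · exact hQR h2) (by
      intro i _ j _ hij h
      have h2 : c (2 * i) ∈ ({c (2 * j), c (2 * j + 1), z j} : Finset Plane) := by
        exact h ▸ Finset.mem_insert_self _ _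
      simp only [Finset.mem_insert, Finset.mem_singleton] at h2
      rcases h2 with h2 | h2 | h2
      · have := hcinj h2; omega
      · have := hcinj h2; omega
      · exact hzc _ _ h2) (fun j _ => toothTip_mem_openCell (hlt _) hη0 hη1 (hz2 j))
  obtain ⟨T₅, hv₅, hc₅, hd₅, hh₅, hr₅⟩ := T₄.exists_fill f
  have hflat : ∀ u, T₃.height u = 0 := fun u => by rw [hh₃, hh₂, hh₁, hh₀]
  have hv₂₅ : T₂.vertices ⊆ T₅.vertices := by
    refine Finset.Subset.trans ?_ (hv₄.trans hv₅)
    rw [hv₃]; exact Finset.subset_union_left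
  -- The slivers are triangles of `T₁`; whatever is subdivided later, no final triangle meets the
  -- open cells of two of them.
  have hr₅₁ : T₅.Refines T₁ := hr₅.trans (hr₄.trans (hr₃.trans hr₂))
  refine ⟨T₅, fun j => openCell {c (2 * j), c (2 * j + 1), d j}, ?_, ?_, ?_, ?_, ?_, ?_, ?_, ?_, ?_,
    ?_, ?_⟩
  · rw [hc₅, hc₄, hc₃, hc₂, hc₁, hc₀]; ring
  · intro i hi
    refine hv₂₅ ?_
    rw [hv₂]
    exact Finset.mem_union_right _ (Finset.mem_image.2 ⟨i, Finset.mem_range.2 hi, rfl⟩)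
  · intro i hi
    refine hv₅ (hv₄ ?_)
    rw [hv₃]
    exact Finset.mem_union_right _ (Finset.mem_image.2 ⟨i, Finset.mem_range.2 hi, rfl⟩)
  · intro x y hx hy
    rw [hd₅, hd₄, hd₃, hd₂, hd₁, hd₀]
    refine interior_maximal (openCell_subset_convexHull _) (openCell_triple_isOpen ?_)
      (mem_openCell_domain hX0 hx hy)
    dsimp only; nlinarith
  · intro j hj
    obtain ⟨p, e, h1, h2, -⟩ := hdj j hj
    rw [h1]
    exact tooth_isOpen (hlt _) h2
  · intro j hj
    have hv : ∀ i ≤ 2 * N + 1, c i ∈ T₃.vertices := by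
      intro i hi
      rw [hv₃, hv₂, hv₁]
      refine Finset.mem_union_left _ (Finset.mem_union_left _ ?_)
      rcases i with _ | i
      · refine Finset.mem_union_left _ ?_
        rw [hv₀, hc0]; exact Finset.mem_insert_self _ _
      · exact Finset.mem_union_right _ (Finset.mem_image.2 ⟨i, Finset.mem_range.2 (by omega), rfl⟩)
    rw [hd₅, hd₄]
    refine T₃.openCell_subset_domain fun v hv' => ?_
    simp only [Finset.mem_insert, Finset.mem_singleton] at hv'
    rcases hv' with rfl | rfl | rfl
    · exact T₃.mem_domain_of_mem_vertices (hv _ (by omega))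
    · exact T₃.mem_domain_of_mem_vertices (hv _ (by omega))
    · refine T₃.openCell_subset_domain ?_ (toothTip_mem_openCell (hlt _) hη0 hη1 (hz2 j))
      intro v hv'
      simp only [Finset.mem_insert, Finset.mem_singleton] at hv'
      rcases hv' with rfl | rfl | rfl
      · exact T₃.mem_domain_of_mem_vertices (hv (2 * j) (by omega))
      · exact T₃.mem_domain_of_mem_vertices (hv (2 * j + 1) (by omega))
      · by_cases hj0 : j = 0
        · rw [hj0, hz0]
          refine T₃.mem_domain_of_mem_vertices ?_
          rw [hv₃, hv₂]
          refine Finset.mem_union_left _ (Finset.mem_union_right _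
            (Finset.mem_image.2 ⟨0, Finset.mem_range.2 (by omega), ?_⟩))
          change ((-(S + (0 : ℕ)), -1) : Plane) = _
          rw [Nat.cast_zero, add_zero]
        · rw [hzs j hj0]
          refine T₃.mem_domain_of_mem_vertices ?_
          rw [hv₃, hv₂, hv₁, hv₀]
          simp
  · intro j hj u hu
    rw [hh₅, ← hflat u]
    exact hpos j (by omega) u hu
  · intro u hu
    rw [hh₅, hzero u fun j hj => hu j (by omega), hflat]
  · intro j hj u hu
    obtain ⟨p, e, h1, h2, h3, h4, h5⟩ := hdj j hj
    rw [h1] at hu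
    obtain ⟨k1, k2, k3, k4⟩ := tooth_bounds h2 h4 h5 (hlt _).le hu
    exact ⟨k1, k2, by linarith, k4⟩
  · intro j hj x hx1 hx2 ξ
    obtain ⟨p, e, h1, h2, -⟩ := hdj j hj
    rw [h1]
    exact tooth_blocks h2 hx1 hx2 ξ
  · intro i hi i' hi' hne u hu u' hu' t ht hut hut'
    obtain ⟨s, hs, hts⟩ := hr₅₁ t ht
    have h1 := T₁.eq_of_mem_openCell hs (hQ₁ i hi) hu (hts hut)
    have h2 := T₁.eq_of_mem_openCell hs (hQ₁ i' hi') hu' (hts hut')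
    have h3 : ({c i, c (i + 1), (X, X)} : Finset Plane) = {c i', c (i' + 1), (X, X)} := h1.symm.trans h2
    have h4 : c i ∈ ({c i', c (i' + 1), (X, X)} : Finset Plane) := by rw [← h3]; simp
    have h5 : c (i + 1) ∈ ({c i', c (i' + 1), (X, X)} : Finset Plane) := by rw [← h3]; simp
    simp only [Finset.mem_insert, Finset.mem_singleton] at h4 h5
    have h6 := (h4.imp_right fun h => h.resolve_right fun h => hQc _ h.symm).imp
      (fun h => hcinj h) (fun h => hcinj h)
    have h7 := (h5.imp_right fun h => h.resolve_right fun h => hQc _ h.symm).imp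
      (fun h => hcinj h) (fun h => hcinj h)
    omega

/-! ### Visibility through the comb -/

namespace IsComb

variable {m N kA kB : ℕ} {T : Terrain} {O : ℕ → Set Plane}

theorem height_eq_zero_of_pos (h : IsComb m N kA kB T O) {u : Plane} (hu : 0 < u.2) :
    T.height u = 0 :=
  h.height_eq_zero u fun j hj huj => absurd (h.bounds j hj u huj).2.2.2 (not_le.2 hu)

theorem height_viewpoint (h : IsComb m N kA kB T O) (s : ℝ) : T.height (s, -1) = 0 := by
  refine h.height_eq_zero _ fun j hj huj => ?_
  have h1 := (h.bounds j hj _ huj).2.2.1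
  have h2 := combGap_le (m := m) (N := N)
  have h3 := combSize_ge (m := m) (N := N)
  have h4 := one_le_combShift (m := m) (N := N)
  have hm : (0 : ℝ) ≤ m := by positivity
  have h5 : combGap m N / combSize m N < 1 := by
    rw [div_lt_one (by linarith)]; linarith
  dsimp only at h1
  linarith

/-- A viewpoint sees everything on the line from it through the middle of a gap. -/
theorem sees_of_line (h : IsComb m N kA kB T O) {s : ℝ} (hs : ((s, -1) : Plane) ∈ T.vertices)
    (hsb : |s| ≤ combShift m N + m) {j : ℕ} (hj : j < N) {u : Plane} (hu : u ∈ T.domain)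
    (hline : u.1 = (1 + u.2) * (m * j) - u.2 * s) : T.Sees (s, -1) u := by
  refine T.sees_of_height_eq_zero (T.mem_domain_of_mem_vertices hs) hu ?_
  rintro v ⟨a, b, ha, hb, hab, rfl⟩
  refine h.height_eq_zero _ fun l hl hvl => ?_
  obtain ⟨h1, h2, h3, h4⟩ := h.bounds l hl _ hvl
  have hX := combSize_ge (m := m) (N := N)
  have hS := one_le_combShift (m := m) (N := N)
  have hw := combGap_pos (m := m) (N := N)
  have hm : (0 : ℝ) ≤ m := by positivity
  have hX0 : 0 < combSize m N := by linarith
  set v : Plane := a • ((s, -1) : Plane) + b • u with hv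
  have hv1 : v.1 = a * s + b * u.1 := by simp [hv]
  have hv2 : v.2 = -a + b * u.2 := by simp [hv]
  have hvl : v.1 = m * j + v.2 * (m * j - s) := by
    rw [hv1, hv2, hline, show b = 1 - a by linarith]; ring
  have hj' : (j : ℝ) ≤ N := by exact_mod_cast hj.le
  have hmj : (m : ℝ) * j ≤ combShift m N := by
    unfold combShift
    have := mul_le_mul_of_nonneg_left hj' hm
    linarith
  have hmj0 : (0 : ℝ) ≤ m * j := by positivity
  -- At the level of the teeth, `|v.2|` is at most `combGap / combSize`, while the horizontal run
  -- per unit of depth is less than `combSize`. So the line stays within the gap.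
  have hdist : |v.2 * (m * j - s)| < combGap m N := by
    rw [abs_mul]
    have e1 : |v.2| ≤ combGap m N / combSize m N := abs_le.2 ⟨h3, h4.trans (by positivity)⟩
    have e2 : |(m : ℝ) * j - s| < combSize m N := by
      rw [abs_le] at hsb
      rw [abs_lt]; constructor <;> linarith
    calc |v.2| * |(m : ℝ) * j - s| ≤ combGap m N / combSize m N * |(m : ℝ) * j - s| :=
          mul_le_mul_of_nonneg_right e1 (abs_nonneg _)
      _ < combGap m N / combSize m N * combSize m N :=
          mul_lt_mul_of_pos_left e2 (by positivity)
      _ = combGap m N := div_mul_cancel₀ _ hX0.ne'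
  rw [abs_lt] at hdist
  rcases le_or_gt l j with hlj | hlj
  · rw [combAbscissa_odd] at h2
    have : (m : ℝ) * l ≤ m * j := mul_le_mul_of_nonneg_left (by exact_mod_cast hlj) hm
    linarith
  · obtain ⟨l, rfl⟩ := Nat.exists_eq_succ_of_ne_zero (by omega : l ≠ 0)
    rw [show 2 * l.succ = 2 * l + 2 from rfl, combAbscissa_even] at h1
    have : (m : ℝ) * j ≤ m * l := mul_le_mul_of_nonneg_left (by exact_mod_cast (by omega)) hm
    linarith

/-- A viewpoint does not see what lies behind the base of a tooth. -/
theorem eventually_not_sees_of_tooth (h : IsComb m N kA kB T O) {s x y : ℝ} (hy : 0 < y) {j : ℕ}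
    (hj : j ≤ N) (h1 : combAbscissa m N (2 * j) < x) (h2 : x < combAbscissa m N (2 * j + 1)) :
    ∀ᶠ u in 𝓝 ((x * (1 + y) - y * s, y) : Plane), ¬ T.Sees (s, -1) u := by
  -- The line from `(x, 0)` to the viewpoint `(s, -1)` has direction `(s - x, -1)`, so just in front
  -- of the base it runs over the tooth.
  have hε := (h.blocks j hj x h1 h2 (s - x)).and
    (Ioo_mem_nhdsGT (show (0 : ℝ) < 1 by norm_num))
  obtain ⟨ε, hεO, hε0, hε1⟩ := hε.exists
  refine T.eventually_not_sees (h.height_viewpoint s) ?_ (h.isOpen j hj) (h.subset_domain j hj)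
    (h.height_pos j hj) (s := (1 - ε) / (1 + y)) ?_ ?_ ?_
  · have : ∀ᶠ u : Plane in 𝓝 ((x * (1 + y) - y * s, y) : Plane), 0 < u.2 :=
      (isOpen_lt continuous_const continuous_snd).mem_nhds hy
    exact this.mono fun u hu => h.height_eq_zero_of_pos hu
  · exact div_nonneg (by linarith) (by linarith)
  · rw [div_le_one (by linarith)]; linarith
  · convert hεO using 1
    have : (1 : ℝ) + y ≠ 0 := by linarith
    ext
    · simp only [Prod.smul_mk, smul_eq_mul, Prod.mk_add_mk]
      field_simp; ring
    · simp only [Prod.smul_mk, smul_eq_mul, Prod.mk_add_mk]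
      field_simp; ring

/-- The target lies on the line of a fictitious viewpoint `s'` through the middle of gap `j`. Seen
from `s`, it appears through the point of the base shifted by `τ * (s - s')` with `τ = y / (1 + y)`:
far enough to leave the gap, too little to cross the whole neighbouring tooth. -/
theorem eventually_not_sees (h : IsComb m N kA kB T O) (hm : 1 ≤ m) {s s' y : ℝ}
    (hs : 1 / 2 ≤ |s - s'|) (hs' : |s - s'| < m) (hy : 1 / (4 * combShift m N) ≤ y) (hy1 : y ≤ 1)
    {j : ℕ} (hj : j < N) :
    ∀ᶠ u in 𝓝 (((1 + y) * (m * j) - y * s', y) : Plane), ¬ T.Sees (s, -1) u := by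
  have hS := one_le_combShift (m := m) (N := N)
  have hw := combGap_pos (m := m) (N := N)
  have hw' := combGap_le (m := m) (N := N)
  have hX := combSize_ge (m := m) (N := N)
  have hm' : (1 : ℝ) ≤ m := by exact_mod_cast hm
  -- This is where the factor 32 in `combGap` enters: with `τ ≥ y / 2` and `|s - s'| ≥ 1 / 2` the
  -- shift is at least `2 * combGap`. The bound `τ ≤ 1 / 2` keeps it below `m / 2`.
  have hy8 : 8 * combGap m N ≤ y := by
    refine le_trans (le_of_eq ?_) hy
    unfold combGap; field_simp; norm_num
  have hy0 : 0 < y := by linarith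
  set τ := y / (1 + y) with hτ
  have hτ1 : τ ≤ 1 / 2 := by rw [hτ, div_le_iff₀ (by linarith)]; linarith
  have hτ2 : y / 2 ≤ τ := by
    rw [hτ, le_div_iff₀ (by linarith)]; nlinarith
  have hτ0 : 0 < τ := by linarith
  have hx : ((1 + y) * (m * j) - y * s' : ℝ) = (m * j + τ * (s - s')) * (1 + y) - y * s := by
    have : τ * (1 + y) = y := by rw [hτ]; field_simp
    linear_combination (-(s - s')) * this
  rw [hx]
  rcases le_total 0 (s - s') with hs0 | hs0
  · rw [abs_of_nonneg hs0] at hs hs'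
    have e1 : combGap m N < τ * (s - s') := by nlinarith
    have e2 : τ * (s - s') < m / 2 := by nlinarith
    refine h.eventually_not_sees_of_tooth hy0 (j := j + 1) (by omega) ?_ ?_
    · rw [show 2 * (j + 1) = 2 * j + 2 by ring, combAbscissa_even]; linarith
    · rw [combAbscissa_odd]; push_cast; linarith
  · rw [abs_of_nonpos hs0] at hs hs'
    have e1 : combGap m N < τ * -(s - s') := by nlinarith
    have e2 : τ * -(s - s') < m / 2 := by nlinarith
    refine h.eventually_not_sees_of_tooth hy0 (j := j) hj.le ?_ ?_
    · rcases j with _ | j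
      · rw [mul_zero, combAbscissa_zero]; push_cast; linarith
      · rw [show 2 * (j + 1) = 2 * j + 2 by ring, combAbscissa_even]; push_cast; linarith
    · rw [combAbscissa_odd]; linarith

end IsComb

/-! ### Separation of the unseen points by sight lines -/

/-- The lines of sight of one family separate points between them. -/
theorem exists_separating_line {m k : ℕ} (hk : k ≤ m) {σ : ℝ} (hσ : σ = 1 ∨ σ = -1)
    {j i j' i' : ℕ} (hi : i < k) (hi' : i' < k) (hne : j = j' → i ≠ i') {y y' : ℝ} (hy : 0 < y)
    (hy' : 0 < y') :
    ∃ a b : ℕ, (a = j ∨ a = j') ∧ (b = i ∨ b = i') ∧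
      ((1 + y) * (m * ((j : ℝ) - a)) + σ * y * (i + 1 / 2 - b)) *
        ((1 + y') * (m * ((j' : ℝ) - a)) + σ * y' * (i' + 1 / 2 - b)) < 0 := by
  wlog hlt : j < j' ∨ (j = j' ∧ i < i') generalizing j i j' i' y y'
  · obtain ⟨a, b, ha, hb, hab⟩ := this (j := j') (i := i') (j' := j) (i' := i) hi' hi
      (fun h h' => hne h.symm h'.symm) hy' hy (by
        rcases lt_trichotomy j j' with h | h | h
        · exact absurd (Or.inl h) hlt
        · have := hne h; right; refine ⟨h.symm, ?_⟩
          by_contra hc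
          exact hlt (Or.inr ⟨h, by omega⟩)
        · exact Or.inl h)
    exact ⟨a, b, ha.symm, hb.symm, by rwa [mul_comm]⟩
  have him : (i : ℝ) + 1 ≤ m := by exact_mod_cast (by omega : i + 1 ≤ m)
  have him' : (i' : ℝ) + 1 ≤ m := by exact_mod_cast (by omega : i' + 1 ≤ m)
  have hi0 : (0 : ℝ) ≤ i := by positivity
  have hi0' : (0 : ℝ) ≤ i' := by positivity
  rcases hlt with hlt | ⟨rfl, hlt⟩
  · have hj : (j : ℝ) + 1 ≤ j' := by exact_mod_cast hlt
    -- Neighbouring gaps are `m` apart and a family spans less than `m`, so the gap term decides the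
    -- sign at one point; at the other it vanishes and the half step `1 / 2` decides. Which point's
    -- own line to take depends on the side `σ`.
    have hmj : (m : ℝ) ≤ m * ((j' : ℝ) - j) := by nlinarith
    rcases hσ with rfl | rfl
    · refine ⟨j', i', Or.inr rfl, Or.inr rfl, mul_neg_of_neg_of_pos ?_ ?_⟩
      · nlinarith
      · rw [sub_self, mul_zero, mul_zero]; nlinarith
    · refine ⟨j, i, Or.inl rfl, Or.inl rfl, mul_neg_of_neg_of_pos ?_ ?_⟩
      · rw [sub_self, mul_zero, mul_zero]; nlinarith
      · nlinarith
  · have hii : (i : ℝ) + 1 ≤ i' := by exact_mod_cast hlt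
    -- In the same gap, the line of viewpoint `i'` runs between the half-integer positions `i + 1 /
    -- 2` and `i' + 1 / 2`.
    refine ⟨j, i', Or.inl rfl, Or.inr rfl, ?_⟩
    have hσ2 : σ * σ = 1 := by rcases hσ with rfl | rfl <;> norm_num
    have e : ((1 + y) * (m * ((j : ℝ) - j)) + σ * y * (i + 1 / 2 - i')) *
        ((1 + y') * (m * ((j : ℝ) - j)) + σ * y' * (i' + 1 / 2 - i')) =
        (σ * σ) * (y * y') * ((i + 1 / 2 - i') / 2) := by ring
    rw [e, hσ2, one_mul]
    exact mul_neg_of_pos_of_neg (mul_pos hy hy') (by linarith)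

/-- The separating function vanishes exactly on the line of viewpoint `b` through gap `a`, all of
which is visible within the domain. The sign `σ` treats the left (`1`) and right (`-1`) families
alike. -/
theorem IsComb.separated {m N kA kB : ℕ} {T : Terrain} {O : ℕ → Set Plane}
    (h : IsComb m N kA kB T O) {P : Finset Plane} (hPv : P ⊆ T.vertices) {k : ℕ} (hk : k ≤ m)
    {σ : ℝ} (hσ : σ = 1 ∨ σ = -1)
    (hP : ∀ i < k, ((-(σ * (combShift m N + i)), -1) : Plane) ∈ P) {j i j' i' : ℕ} (hj : j < N)
    (hj' : j' < N) (hi : i < k) (hi' : i' < k) (hne : j = j' → i ≠ i') {q q' : Plane}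
    (hy : 0 < q.2) (hy' : 0 < q'.2)
    (hq : q.1 = (1 + q.2) * (m * j) + q.2 * (σ * (combShift m N + i + 1 / 2)))
    (hq' : q'.1 = (1 + q'.2) * (m * j') + q'.2 * (σ * (combShift m N + i' + 1 / 2))) :
    T.Separated (T.viewshedOf P) q q' := by
  obtain ⟨a, b, ha, hb, hab⟩ := exists_separating_line hk hσ hi hi' hne hy hy'
  have haN : a < N := by rcases ha with rfl | rfl <;> assumption
  have hbk : b < k := by rcases hb with rfl | rfl <;> assumption
  refine Or.inl ⟨fun u => u.1 - (1 + u.2) * (m * a) - u.2 * (σ * (combShift m N + b)), by fun_prop,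
    ?_, fun u hu hu0 => ?_⟩
  · dsimp only
    rw [hq, hq']
    convert hab using 2 <;> ring
  · refine Set.mem_biUnion (x := ((-(σ * (combShift m N + b)), -1) : Plane)) (hP b hbk) ?_
    refine h.sees_of_line (hPv (hP b hbk)) ?_ haN hu (by linarith)
    have hS := one_le_combShift (m := m) (N := N)
    have hbm : (b : ℝ) ≤ m := by exact_mod_cast (by omega : b ≤ m)
    have hb0 : (0 : ℝ) ≤ b := by positivity
    rw [abs_neg, abs_mul, show |σ| = 1 by rcases hσ with rfl | rfl <;> simp, one_mul,
      abs_of_nonneg (by linarith)]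
    linarith

theorem mul_le_complexities {T : Terrain} {P : Finset Plane} {ι : Type*} [Fintype ι]
    (q : ι → Plane) (hq : ∀ x, q x ∈ interior T.domain)
    (hP : ∀ x, ∀ p ∈ P, ∀ᶠ u in 𝓝 (q x), ¬ T.Sees p u)
    (hsep : ∀ x y, x ≠ y → T.Separated (T.viewshedOf P) (q x) (q y)) {M C : ℕ}
    (hM : M ≤ C * Fintype.card ι) :
    (M : ℕ∞) ≤ C * T.complexity (T.visMap P) ∧ (M : ℕ∞) ≤ C * T.complexity (T.colVisMap P) ∧
      (M : ℕ∞) ≤ C * T.complexity (T.vorVisMap P) := by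
  have hV : ∀ x, ∀ᶠ u in 𝓝 (q x), u ∉ T.viewshedOf P := by
    intro x
    have h1 : ∀ᶠ u in 𝓝 (q x), ∀ p ∈ P, ¬ T.Sees p u :=
      (Filter.eventually_all_finset P).2 (hP x)
    refine h1.mono fun u hu hu' => ?_
    simp only [Terrain.viewshedOf, Set.mem_iUnion, exists_prop] at hu'
    obtain ⟨p, hp, hpu⟩ := hu'
    exact hu p hp hpu
  have hM' : (M : ℕ∞) ≤ C * ENat.card ι := by
    rw [ENat.card_eq_coe_fintype_card]; exact_mod_cast hM
  have key : ∀ {c : ℕ∞}, ENat.card ι ≤ c → (M : ℕ∞) ≤ C * c := fun hc =>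
    hM'.trans (by gcongr)
  exact ⟨key (T.card_le_complexity _ (T.visMap_eq_false_iff P) q hq hV hsep),
    key (T.card_le_complexity _ (T.colVisMap_eq_empty_iff P) q hq hV hsep),
    key (T.card_le_complexity _ (T.vorVisMap_eq_empty_iff P) q hq hV hsep)⟩

/-! ### The viewpoints and the points invisible to them -/

/-- `kA` viewpoints on the left and `kB` viewpoints on the right. -/
noncomputable def combViewpoints (m N kA kB : ℕ) : Finset Plane :=
  (Finset.range kA).image (fun i : ℕ => ((-(combShift m N + i), -1) : Plane)) ∪
    (Finset.range kB).image (fun i : ℕ => ((combShift m N + i, -1) : Plane))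

theorem mem_combViewpoints {m N kA kB : ℕ} {p : Plane} :
    p ∈ combViewpoints m N kA kB ↔ (∃ i < kA, p = (-(combShift m N + i), -1)) ∨
      ∃ i < kB, p = (combShift m N + i, -1) := by
  simp only [combViewpoints, Finset.mem_union, Finset.mem_image, Finset.mem_range, eq_comm]

theorem card_combViewpoints (m N kA kB : ℕ) : (combViewpoints m N kA kB).card = kA + kB := by
  have hS := one_le_combShift (m := m) (N := N)
  rw [combViewpoints, Finset.card_union_of_disjoint, Finset.card_image_of_injective,
    Finset.card_image_of_injective, Finset.card_range, Finset.card_range]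
  · intro i j h
    have := congrArg Prod.fst h
    dsimp only at this
    exact_mod_cast (by linarith : (i : ℝ) = j)
  · intro i j h
    have := congrArg Prod.fst h
    dsimp only at this
    exact_mod_cast (by linarith : (i : ℝ) = j)
  · rw [Finset.disjoint_left]
    intro p hp hp'
    simp only [Finset.mem_image, Finset.mem_range] at hp hp'
    obtain ⟨i, -, rfl⟩ := hp
    obtain ⟨j, -, hj⟩ := hp'
    have := congrArg Prod.fst hj
    dsimp only at this
    have h1 : (0 : ℝ) ≤ i := by positivity
    have h2 : (0 : ℝ) ≤ j := by positivity
    linarith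

theorem half_le_abs_of_nat (i j : ℕ) : 1 / 2 ≤ |(i : ℝ) + 1 / 2 - j| := by
  rcases le_or_gt j i with h | h
  · have : (j : ℝ) ≤ i := by exact_mod_cast h
    rw [le_abs]; left; linarith
  · have : (i : ℝ) + 1 ≤ j := by exact_mod_cast h
    rw [le_abs]; right; linarith

theorem abs_lt_of_nat {m i j : ℕ} (hi : i < m) (hj : j < m) : |(i : ℝ) + 1 / 2 - j| < m := by
  have h1 : (i : ℝ) + 1 ≤ m := by exact_mod_cast hi
  have h2 : (j : ℝ) + 1 ≤ m := by exact_mod_cast hj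
  have h3 : (0 : ℝ) ≤ i := by positivity
  have h4 : (0 : ℝ) ≤ j := by positivity
  rw [abs_lt]; constructor <;> linarith

namespace IsComb

variable {m N kA kB : ℕ} {T : Terrain} {O : ℕ → Set Plane}

theorem combViewpoints_subset (h : IsComb m N kA kB T O) :
    combViewpoints m N kA kB ⊆ T.vertices := by
  intro p hp
  rcases mem_combViewpoints.1 hp with ⟨i, hi, rfl⟩ | ⟨i, hi, rfl⟩
  · exact h.mem_left i hi
  · exact h.mem_right i hi

theorem eventually_not_sees_left (h : IsComb m N kA kB T O) (hA : kA ≤ m) {q : Plane}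
    (hy : 1 / (4 * combShift m N) ≤ q.2) (hy1 : q.2 ≤ 1) {i j : ℕ} (hi : i < kA) (hj : j < N)
    (hq : q.1 = (1 + q.2) * (m * j) + q.2 * (combShift m N + i + 1 / 2)) {i' : ℕ} (hi' : i' < kA) :
    ∀ᶠ u in 𝓝 q, ¬ T.Sees (-(combShift m N + i'), -1) u := by
  have e : (-(combShift m N + i') : ℝ) - -(combShift m N + i + 1 / 2) = i + 1 / 2 - i' := by ring
  have := h.eventually_not_sees (by omega) (s := -(combShift m N + i'))
    (s' := -(combShift m N + i + 1 / 2)) (by rw [e]; exact half_le_abs_of_nat i i')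
    (by rw [e]; exact abs_lt_of_nat (by omega) (by omega)) hy hy1 hj
  convert this using 2
  refine Prod.ext ?_ rfl
  rw [hq]; ring

theorem eventually_not_sees_right (h : IsComb m N kA kB T O) (hB : kB ≤ m) {q : Plane}
    (hy : 1 / (4 * combShift m N) ≤ q.2) (hy1 : q.2 ≤ 1) {i j : ℕ} (hi : i < kB) (hj : j < N)
    (hq : q.1 = (1 + q.2) * (m * j) - q.2 * (combShift m N + i + 1 / 2)) {i' : ℕ} (hi' : i' < kB) :
    ∀ᶠ u in 𝓝 q, ¬ T.Sees (combShift m N + i', -1) u := by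
  have e : (combShift m N + i' : ℝ) - (combShift m N + i + 1 / 2) = -(i + 1 / 2 - i') := by ring
  have := h.eventually_not_sees (by omega) (s := combShift m N + i')
    (s' := combShift m N + i + 1 / 2) (by rw [e, abs_neg]; exact half_le_abs_of_nat i i')
    (by rw [e, abs_neg]; exact abs_lt_of_nat (by omega) (by omega)) hy hy1 hj
  convert this using 2
  exact Prod.ext hq rfl

theorem mem_interior_domain (h : IsComb m N kA kB T O) (hm : 1 ≤ m) {q : Plane}
    (hy : 0 < q.2) (hy1 : q.2 ≤ 1) {i j : ℕ} (hi : i < m) (hj : j < N)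
    (hq : q.1 = (1 + q.2) * (m * j) + q.2 * (combShift m N + i + 1 / 2)) :
    q ∈ interior T.domain := by
  have hS := one_le_combShift (m := m) (N := N)
  have hX := combSize_ge (m := m) (N := N)
  have hi' : (i : ℝ) + 1 ≤ m := by exact_mod_cast hi
  have hi0 : (0 : ℝ) ≤ i := by positivity
  have hj' : (j : ℝ) ≤ N := by exact_mod_cast hj.le
  have hmj0 : (0 : ℝ) ≤ m * j := by positivity
  have hmj : (m : ℝ) * j ≤ combShift m N := by
    unfold combShift
    have := mul_le_mul_of_nonneg_left hj' (by positivity : (0 : ℝ) ≤ m)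
    linarith
  refine h.mem_interior q.1 q.2 ?_ ?_
  · rw [hq, abs_of_nonneg (by positivity)]
    have e1 : q.2 * (m * j) ≤ 1 * (m * j) := mul_le_mul_of_nonneg_right hy1 hmj0
    have e2 : q.2 * (combShift m N + i + 1 / 2) ≤ 1 * (combShift m N + i + 1 / 2) :=
      mul_le_mul_of_nonneg_right hy1 (by linarith)
    linarith
  · rw [abs_of_pos hy]; linarith

end IsComb

/-! ### Crossing points and the final count -/

/-- The height of the crossing point of the sight lines of a left and a right viewpoint. -/
theorem exists_crossing {m N j j' i i' : ℕ} (hm : 1 ≤ m) (hjj : j < j') (hj' : j' < N) (hi : i < m)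
    (hi' : i' < m) : ∃ y : ℝ, 1 / (4 * combShift m N) ≤ y ∧ y ≤ 1 ∧
      (1 + y) * (m * j) + y * (combShift m N + i + 1 / 2) =
        (1 + y) * (m * j') - y * (combShift m N + i' + 1 / 2) := by
  have hS := one_le_combShift (m := m) (N := N)
  have hm' : (1 : ℝ) ≤ m := by exact_mod_cast hm
  have h1 : (i : ℝ) + 1 ≤ m := by exact_mod_cast hi
  have h2 : (i' : ℝ) + 1 ≤ m := by exact_mod_cast hi'
  have h3 : (0 : ℝ) ≤ i := by positivity
  have h4 : (0 : ℝ) ≤ i' := by positivity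
  have h5 : (j : ℝ) + 1 ≤ j' := by exact_mod_cast hjj
  have h6 : (j' : ℝ) + 1 ≤ N := by exact_mod_cast hj'
  have h7 : (0 : ℝ) ≤ j := by positivity
  have hSdef : combShift m N = m * N + 1 := rfl
  set S := combShift m N
  have hE1 : (m : ℝ) * 1 ≤ m * (j' - j) := mul_le_mul_of_nonneg_left (by linarith) (by linarith)
  have hE2 : (m : ℝ) * (j' - j) ≤ m * N := mul_le_mul_of_nonneg_left (by linarith) (by linarith)
  set E := (m : ℝ) * (j' - j) with hE
  have hD : 0 < 2 * S + i + i' + 1 - E := by linarith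
  -- Solution of the linear equation for `y`. It is positive because `j < j'`, and at most 1 because
  -- `E ≤ m * N < S`; the distance `S` of the viewpoints serves this.
  refine ⟨E / (2 * S + i + i' + 1 - E), ?_, ?_, ?_⟩
  · rw [div_le_div_iff₀ (by linarith) hD]
    nlinarith
  · rw [div_le_one hD]; linarith
  · have : E / (2 * S + i + i' + 1 - E) * (2 * S + i + i' + 1 - E) = E := div_mul_cancel₀ _ hD.ne'
    generalize E / (2 * S + i + i' + 1 - E) = y at this ⊢
    rw [hE] at this
    linear_combination this

/-- The height of the crossing point of a sight line of the viewpoint with a line from the upper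
corner to the base of a tooth. -/
theorem exists_crossing_sliver {N j j' : ℕ} (hjj : j < j') (hj' : j' < N) :
    ∃ y : ℝ, 1 / (4 * combShift 1 N) ≤ y ∧ y ≤ 1 ∧
      (1 + y) * j + y * (combShift 1 N + 1 / 2) =
        (j' + 1 / 2) * (1 - y / combSize 1 N) + y := by
  have hS := one_le_combShift (m := 1) (N := N)
  have hX := combSize_ge (m := 1) (N := N)
  have h5 : (j : ℝ) + 1 ≤ j' := by exact_mod_cast hjj
  have h6 : (j' : ℝ) + 1 ≤ N := by exact_mod_cast hj'
  have h7 : (0 : ℝ) ≤ j := by positivity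
  have hSdef : combShift 1 N = N + 1 := by simp [combShift]
  set S := combShift 1 N
  set X := combSize 1 N
  have hX0 : 0 < X := by push_cast at hX; linarith
  have hr0 : 0 ≤ ((j' : ℝ) + 1 / 2) / X := by positivity
  have hr1 : ((j' : ℝ) + 1 / 2) / X ≤ 1 := by
    rw [div_le_one hX0]; push_cast at hX; linarith
  have hD : 0 < S - 1 / 2 + j + (j' + 1 / 2) / X := by linarith
  refine ⟨(j' + 1 / 2 - j) / (S - 1 / 2 + j + (j' + 1 / 2) / X), ?_, ?_, ?_⟩
  · rw [div_le_div_iff₀ (by linarith) hD]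
    nlinarith
  · rw [div_le_one hD]; linarith
  · have : ((j' : ℝ) + 1 / 2 - j) / (S - 1 / 2 + j + (j' + 1 / 2) / X) *
        (S - 1 / 2 + j + (j' + 1 / 2) / X) = j' + 1 / 2 - j := div_mul_cancel₀ _ hD.ne'
    generalize ((j' : ℝ) + 1 / 2 - j) / (S - 1 / 2 + j + (j' + 1 / 2) / X) = y at this ⊢
    linear_combination this

theorem one_div_combShift_pos (m N : ℕ) : 0 < 1 / (4 * combShift m N) := by
  have hS := one_le_combShift (m := m) (N := N)
  positivity

/-- Left lines use gaps below `N'` and right lines gaps from `N'` on, so each pair crosses behind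
the comb. Two crossing points with different left lines are separated by a ray of the left family,
otherwise by one of the right family. -/
theorem complexity_of_two_families {m N' kA kB : ℕ} {T : Terrain} {O : ℕ → Set Plane}
    (h : IsComb m (2 * N') kA kB T O) (hm : 1 ≤ m) (hA : kA ≤ m) (hB : kB ≤ m) {M C : ℕ}
    (hM : M ≤ C * ((N' * kA) * (N' * kB))) :
    (M : ℕ∞) ≤ C * T.complexity (T.visMap (combViewpoints m (2 * N') kA kB)) ∧
      (M : ℕ∞) ≤ C * T.complexity (T.colVisMap (combViewpoints m (2 * N') kA kB)) ∧
      (M : ℕ∞) ≤ C * T.complexity (T.vorVisMap (combViewpoints m (2 * N') kA kB)) := by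
  have hex : ∀ x : (Fin N' × Fin kA) × (Fin N' × Fin kB), ∃ q : Plane,
      1 / (4 * combShift m (2 * N')) ≤ q.2 ∧ q.2 ≤ 1 ∧
      q.1 = (1 + q.2) * (m * (x.1.1 : ℕ)) + q.2 * (combShift m (2 * N') + (x.1.2 : ℕ) + 1 / 2) ∧
      q.1 = (1 + q.2) * (m * (N' + x.2.1 : ℕ)) -
        q.2 * (combShift m (2 * N') + (x.2.2 : ℕ) + 1 / 2) := by
    rintro ⟨⟨a, b⟩, ⟨c, d⟩⟩
    obtain ⟨y, h1, h2, h3⟩ := exists_crossing (m := m) (N := 2 * N') (j := a) (j' := N' + c) (i := b)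
      (i' := d) hm (by omega) (by omega) (by omega) (by omega)
    exact ⟨(_, y), h1, h2, rfl, h3⟩
  choose q hq1 hq2 hqA hqB using hex
  have hpos : ∀ x, 0 < (q x).2 := fun x => (one_div_combShift_pos _ _).trans_le (hq1 x)
  refine mul_le_complexities q (fun x => ?_) (fun x p hp => ?_) (fun x y hxy => ?_)
    (by simpa [Fintype.card_prod] using hM)
  · exact h.mem_interior_domain hm (hpos x) (hq2 x) (i := x.1.2) (j := x.1.1) (by omega) (by omega)
      (hqA x)
  · rcases mem_combViewpoints.1 hp with ⟨i, hi, rfl⟩ | ⟨i, hi, rfl⟩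
    · exact h.eventually_not_sees_left hA (hq1 x) (hq2 x) x.1.2.2 (by omega) (hqA x) hi
    · exact h.eventually_not_sees_right hB (hq1 x) (hq2 x) x.2.2.2 (by omega) (hqB x) hi
  · by_cases h1 : x.1 = y.1
    · have h2 : x.2 ≠ y.2 := fun h2 => hxy (Prod.ext h1 h2)
      refine h.separated h.combViewpoints_subset hB (σ := -1) (Or.inr rfl) (fun i hi => ?_)
        (j := N' + x.2.1) (i := x.2.2) (j' := N' + y.2.1) (i' := y.2.2) (by omega) (by omega)
        (by omega) (by omega) (fun e e' => h2 ?_) (hpos x) (hpos y) ?_ ?_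
      · rw [mem_combViewpoints]
        exact Or.inr ⟨i, hi, by rw [neg_one_mul, neg_neg]⟩
      · exact Prod.ext (Fin.ext (by omega)) (Fin.ext e')
      · rw [hqB x]; ring
      · rw [hqB y]; ring
    · refine h.separated h.combViewpoints_subset hA (σ := 1) (Or.inl rfl) (fun i hi => ?_)
        (j := x.1.1) (i := x.1.2) (j' := y.1.1) (i' := y.1.2) (by omega) (by omega)
        (by omega) (by omega) (fun e e' => h1 ?_) (hpos x) (hpos y) ?_ ?_
      · rw [mem_combViewpoints]
        exact Or.inl ⟨i, hi, by rw [one_mul]⟩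
      · exact Prod.ext (Fin.ext e) (Fin.ext e')
      · rw [hqA x]; ring
      · rw [hqA y]; ring

/-- Points on the same fictitious line are told apart by the slivers that contain them, points on
different lines by a ray of the single viewpoint. -/
theorem complexity_of_one_viewpoint {N' : ℕ} {T : Terrain} {O : ℕ → Set Plane}
    (h : IsComb 1 (2 * N') 1 0 T O) {M C : ℕ} (hM : M ≤ C * (N' * N')) :
    (M : ℕ∞) ≤ C * T.complexity (T.visMap (combViewpoints 1 (2 * N') 1 0)) ∧
      (M : ℕ∞) ≤ C * T.complexity (T.colVisMap (combViewpoints 1 (2 * N') 1 0)) ∧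
      (M : ℕ∞) ≤ C * T.complexity (T.vorVisMap (combViewpoints 1 (2 * N') 1 0)) := by
  have hS := one_le_combShift (m := 1) (N := 2 * N')
  have hX := combSize_ge (m := 1) (N := 2 * N')
  push_cast at hX
  have hX0 : 0 < combSize 1 (2 * N') := by linarith
  have hex : ∀ x : Fin N' × Fin N', ∃ q : Plane,
      1 / (4 * combShift 1 (2 * N')) ≤ q.2 ∧ q.2 ≤ 1 ∧
      q.1 = (1 + q.2) * ((1 : ℕ) * (x.1 : ℕ)) +
        q.2 * (combShift 1 (2 * N') + (0 : ℕ) + 1 / 2) ∧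
      q.1 = ((N' + x.2 : ℕ) + 1 / 2) * (1 - q.2 / combSize 1 (2 * N')) + q.2 := by
    rintro ⟨a, c⟩
    obtain ⟨y, h1, h2, h3⟩ := exists_crossing_sliver (N := 2 * N') (j := a) (j' := N' + c)
      (by omega) (by omega)
    refine ⟨((1 + y) * (a : ℕ) + y * (combShift 1 (2 * N') + 1 / 2), y), h1, h2, ?_, h3⟩
    push_cast; ring
  choose q hq1 hq2 hqA hqQ using hex
  have hpos : ∀ x, 0 < (q x).2 := fun x => (one_div_combShift_pos _ _).trans_le (hq1 x)
  have hsl : ∀ x, q x ∈ openCell {combPoint 1 (2 * N') (2 * (N' + x.2) + 2),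
      combPoint 1 (2 * N') (2 * (N' + x.2) + 2 + 1), cornerTop 1 (2 * N')} := by
    intro x
    have hy : (q x).2 / combSize 1 (2 * N') < 1 := by
      rw [div_lt_one hX0]; linarith [hq2 x]
    refine mem_openCell_triple (a := (1 - (q x).2 / combSize 1 (2 * N')) / 2)
      (b := (1 - (q x).2 / combSize 1 (2 * N')) / 2) (c := (q x).2 / combSize 1 (2 * N'))
      ?_ ?_ ?_ (by linarith) (by linarith) (div_pos (hpos x) hX0) (by ring) ?_ ?_
    · exact fun e => (combAbscissa_lt_succ (m := 1) (N := 2 * N') le_rfl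
        (2 * (N' + x.2) + 2)).ne (congrArg Prod.fst e)
    · exact fun e => hX0.ne (congrArg Prod.snd e)
    · exact fun e => hX0.ne (congrArg Prod.snd e)
    -- The point was chosen on the median of the sliver, from the midpoint of its base to the
    -- corner; so both base corners get the same weight.
    · rw [hqQ x]
      simp only [combPoint, cornerTop]
      rw [combAbscissa_even, show 2 * (N' + (x.2 : ℕ)) + 2 + 1 = 2 * (N' + x.2 + 1) + 1 by ring,
        combAbscissa_odd, div_mul_cancel₀ _ hX0.ne']
      push_cast; ring
    · simp only [combPoint, cornerTop]
      rw [div_mul_cancel₀ _ hX0.ne']; ring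
  refine mul_le_complexities q (fun x => ?_) (fun x p hp => ?_) (fun x y hxy => ?_)
    (by simpa [Fintype.card_prod] using hM)
  · exact h.mem_interior_domain le_rfl (hpos x) (hq2 x) (i := 0) (j := x.1) (by omega) (by omega)
      (hqA x)
  · rcases mem_combViewpoints.1 hp with ⟨i, hi, rfl⟩ | ⟨i, hi, rfl⟩
    · exact h.eventually_not_sees_left le_rfl (hq1 x) (hq2 x) (i := 0) (by omega) (by omega)
        (hqA x) hi
    · omega
  · by_cases h1 : x.1 = y.1
    · have h2 : (x.2 : ℕ) ≠ y.2 := fun h2 => hxy (Prod.ext h1 (Fin.ext h2))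
      exact Or.inr (h.slivers _ (by omega) _ (by omega) (by omega) _ (hsl x) _ (hsl y))
    · refine h.separated h.combViewpoints_subset le_rfl (σ := 1) (Or.inl rfl) (fun i hi => ?_)
        (j := x.1) (i := 0) (j' := y.1) (i' := 0) (by omega) (by omega)
        (by omega) (by omega) (fun e => absurd (Fin.ext e) h1) (hpos x) (hpos y) ?_ ?_
      · rw [mem_combViewpoints]
        exact Or.inl ⟨i, hi, by rw [one_mul]⟩
      · rw [hqA x]; ring
      · rw [hqA y]; ring

theorem mainTheorem3 :
    ∃ C K : ℕ, ∀ m n : ℕ, 1 ≤ m → K * m ≤ n →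
      ∃ (T : Terrain) (P : Finset Plane),
        T.vertices.card = n ∧ P ⊆ T.vertices ∧ P.card = m ∧
        ((m ^ 2 * n ^ 2 : ℕ) : ℕ∞) ≤ (C : ℕ∞) * T.complexity (T.visMap P) ∧
        ((m ^ 2 * n ^ 2 : ℕ) : ℕ∞) ≤ (C : ℕ∞) * T.complexity (T.colVisMap P) ∧
        ((m ^ 2 * n ^ 2 : ℕ) : ℕ∞) ≤ (C : ℕ∞) * T.complexity (T.vorVisMap P) := by
  -- With `N' = n / 16` the comb takes `8 * N' + 6 + kA + kB` vertices, about `n / 2`, and padding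
  -- supplies the rest; `n ≥ 100 * m` makes it fit and gives `n ≤ 32 * N'`. The constant is `3 * 2 *
  -- 32 ^ 2`, from `m ≤ 3 * kA`, `m ≤ 2 * kB` and `n ≤ 32 * N'`.
  refine ⟨6144, 100, fun m n hm hn => ?_⟩
  obtain ⟨N', hN'⟩ : ∃ N', N' = n / 16 := ⟨_, rfl⟩
  have hnN : n ≤ 32 * N' := by omega
  rcases eq_or_lt_of_le hm with rfl | hm2
  · obtain ⟨T, O, hcard, hT⟩ := exists_isComb (m := 1) (N := 2 * N') (kA := 1) (kB := 0) le_rfl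
      (by omega) le_rfl le_rfl (by omega) (n - (8 * N' + 7))
    refine ⟨T, combViewpoints 1 (2 * N') 1 0, by omega, hT.combViewpoints_subset,
      card_combViewpoints _ _ _ _, complexity_of_one_viewpoint hT ?_⟩
    calc 1 ^ 2 * n ^ 2 = n ^ 2 := by ring
      _ ≤ (32 * N') ^ 2 := Nat.pow_le_pow_left hnN 2
      _ ≤ 6144 * (N' * N') := by ring_nf; omega
  · obtain ⟨kA, hkA⟩ : ∃ kA, kA = m / 2 := ⟨_, rfl⟩
    obtain ⟨kB, hkB⟩ : ∃ kB, kB = m - m / 2 := ⟨_, rfl⟩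
    have hA3 : m ≤ 3 * kA := by omega
    have hB2 : m ≤ 2 * kB := by omega
    obtain ⟨T, O, hcard, hT⟩ := exists_isComb (m := m) (N := 2 * N') (kA := kA) (kB := kB) hm
      (by omega) (by omega) (by omega) (by omega) (n - (8 * N' + 6 + m))
    refine ⟨T, combViewpoints m (2 * N') kA kB, by omega, hT.combViewpoints_subset,
      (card_combViewpoints _ _ _ _).trans (by omega),
      complexity_of_two_families hT hm (by omega) (by omega) ?_⟩
    calc m ^ 2 * n ^ 2 = (m * m) * (n * n) := by ring
      _ ≤ ((3 * kA) * (2 * kB)) * ((32 * N') * (32 * N')) :=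
        Nat.mul_le_mul (Nat.mul_le_mul hA3 hB2) (Nat.mul_le_mul hnN hnN)
      _ = 6144 * ((N' * kA) * (N' * kB)) := by ring
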